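/- **Setting.** Let $\Omega\subset\mathbb R^2$ be a bounded polygonal domain with a conforming triangulation $\mathcal T_0$, and let $\mathcal T_k$ ($k=0,1,2,\dots$) be obtained from $\mathcal T_0$ by $k$ uniform refinements (every triangle is divided into four by its edge midpoints); $h_k$ is the length of the largest edge of $\mathcal T_k$. Let $X_k=U_k\times P_k$ be the Taylor–Hood space: $U_k$ is the space of continuous, piecewise quadratic vector fields that vanish on $\partial\Omega$, and $P_k$ is the space of continuous, piecewise affine functions with mean value zero. For $\beta>0$ put $a(u,\tilde u)=(\nabla u,\nabla\tilde u)_{L^2(\Omega)}+\beta(u,\tilde u)_{L^2(\Omega)}$, $b(u,\tilde p)=(\nabla\cdot u,\tilde p)_{L^2(\Omega)}$ and $\mathcal B((u,p),(\tilde u,\tilde p))=a(u,\tilde u)+b(\tilde u,p)+b(u,\tilde p)$. With respect to any bases of $U_k$ and $P_k$, let $A_k$, $B_k$ be the matrices representing $a$ and $b$, let $M_{U,k}$, $M_{P,k}$ be the mass matrices, and let $$\hat A_k=(h_k^{-2}+\beta)M_{U,k},\qquad \hat S_k=h_k^{-2}(\beta+h_k^{-2})^{-1}M_{P,k},\qquad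 \mathcal L_k=\begin{pmatrix}\hat A_k&0\\0&\hat S_k\end{pmatrix},\qquad |||x_k|||_k^2=(\mathcal L_k\underline x_k,\underline x_k)_{\ell^2},$$ where $\underline x_k$ is the coefficient vector of $x_k\in X_k$. For damping parameters $\tau,\sigma>0$ and a right-hand side $(\underline f_k,\underline g_k)$, one step of the Uzawa-type smoother maps $(\underline u,\underline p)$ to $(\underline u^{+},\underline p^{+})$, where $$\underline u^{1/2}=\underline u+\tau\hat A_k^{-1}(\underline f_k-A_k\underline u-B_k^T\underline p),\quad \underline p^{+}=\underline p-\sigma\hat S_k^{-1}(\underline g_k-B_k\underline u^{1/2}),\quad \underline u^{+}=\underline u+\tau\hat A_k^{-1}(\underline f_k-A_k\underline u-B_k^T\underline p^{+}).$$ **Lemma.** (i) There are $\tau,\sigma>0$, independent of $k$, of $\beta$ and of the bases, such that for all $k\ge 0$ and all $\beta>0$, in the order of symmetric matrices, $$\tau^{-1}\hat A_k\ \ge\ A_k\qquad\text{and}\qquad \sigma^{-1}\hat S_k\ \ge\ \tau B_k\hat A_k^{-1}B_k^T. \tag{1}$$ (ii) For all $\tau,\sigma>0$ that satisfy (1) for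 all $k$ and $\beta$, there is a constant $C_S>0$, independent of $k$, of $\beta$ and of the bases, such that the Uzawa-type smoother satisfies the smoothing property with rate $\eta(\nu)=C_S\nu^{-1/2}$: for all $k\ge0$, all $\beta>0$, every linear functional $\mathcal F$ on $X_k$, every $x_k^*\in X_k$ with $\mathcal B(x_k^*,\tilde x_k)=\mathcal F(\tilde x_k)$ for all $\tilde x_k\in X_k$, every $x_k^{(0)}\in X_k$ and every $\nu\ge1$, the result $x_k^{(0,\nu)}$ of $\nu$ smoothing steps for the right-hand side $\mathcal F$, started at $x_k^{(0)}$, satisfies $$\sup_{0\ne\tilde x_k\in X_k}\frac{\mathcal B\bigl(x_k^{(0,\nu)}-x_k^*,\tilde x_k\bigr)}{|||\tilde x_k|||_k}\ \le\ \eta(\nu)\,|||x_k^{(0)}-x_k^*|||_k ,$$ and $\eta(\nu)\to0$ as $\nu\to\infty$. -/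

import Mathlib

open MeasureTheory
open scoped NNReal Matrix

noncomputable section

namespace Stokes

/-- The Euclidean plane. -/
abbrev Plane : Type := EuclideanSpace ℝ (Fin 2)

/-- A bounded polygonal domain: a bounded open connected set that lies nowhere on both sides of
its boundary in the sense `interior (closure Ω) = Ω`, and whose boundary consists of parts of
finitely many line segments. -/
structure IsPolygonalDomain (Ω : Set Plane) : Prop where
  isOpen : IsOpen Ω
  isConnected : IsConnected Ω
  isBounded : Bornology.IsBounded Ω
  interior_closure : interior (closure Ω) = Ω
  boundary : ∃ S : Finset (Plane × Plane), frontier Ω ⊆ ⋃ e ∈ S, segment ℝ e.1 e.2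

/-- A conforming triangulation of `closure Ω`. A triangle is given by the set of its vertices. -/
structure Triangulation (Ω : Set Plane) where
  triangles : Finset (Finset Plane)
  card_eq : ∀ t ∈ triangles, t.card = 3
  indep : ∀ t ∈ triangles, AffineIndependent ℝ ((↑) : t → Plane)
  /-- Two triangles meet in the convex hull of their common vertices: in a common edge, a common
  vertex, or not at all. -/
  conforming : ∀ s ∈ triangles, ∀ t ∈ triangles,
    convexHull ℝ (s : Set Plane) ∩ convexHull ℝ (t : Set Plane)
      = convexHull ℝ ((s : Set Plane) ∩ (t : Set Plane))
  cover : ⋃ t ∈ triangles, convexHull ℝ (t : Set Plane) = closure Ω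

open Classical in
/-- Uniform refinement of a triangle: for each vertex `v` the triangle formed by `v` and the
midpoints of the two edges at `v`, and the triangle formed by the three edge midpoints
(the midpoint of the edge opposite to `x` is half of the sum of the other two vertices). -/
def refineTriangle (t : Finset Plane) : Finset (Finset Plane) :=
  insert (t.image fun x => (1 / 2 : ℝ) • ((∑ y ∈ t, y) - x))
    (t.image fun v => t.image fun x => midpoint ℝ v x)

/-! ### The bilinear forms -/

/-- `∂_j u_i` at `x`. For piecewise polynomial `u` this is the classical derivative inside each
triangle, hence almost everywhere. -/
def partialDeriv (u : Plane → Plane) (i j : Fin 2) (x : Plane) : ℝ :=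
  (fderiv ℝ u x (EuclideanSpace.single j 1)) i

/-- The divergence `∇ · u`. -/
def divergence (u : Plane → Plane) (x : Plane) : ℝ := ∑ i, partialDeriv u i i x

/-- `(∇ u, ∇ w)` in `L²(Ω)`. -/
def gradInner (Ω : Set Plane) (u w : Plane → Plane) : ℝ :=
  ∫ x in Ω, ∑ i, ∑ j, partialDeriv u i j x * partialDeriv w i j x

/-- `(u, w)` in `L²(Ω)` for vector fields. -/
def vecInner (Ω : Set Plane) (u w : Plane → Plane) : ℝ := ∫ x in Ω, ∑ i, u x i * w x i

/-- `(p, q)` in `L²(Ω)` for scalar functions. -/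
def scalInner (Ω : Set Plane) (p q : Plane → ℝ) : ℝ := ∫ x in Ω, p x * q x

/-- `a(u, w) = (∇ u, ∇ w) + β (u, w)`. -/
def aForm (Ω : Set Plane) (β : ℝ) (u w : Plane → Plane) : ℝ :=
  gradInner Ω u w + β * vecInner Ω u w

/-- `b(u, p) = (∇ · u, p)`. -/
def bForm (Ω : Set Plane) (u : Plane → Plane) (p : Plane → ℝ) : ℝ :=
  scalInner Ω (divergence u) p

/-! ### Finite element spaces -/

/-- `v` is on each triangle of `M` a polynomial of total degree at most `r`. -/
def IsPiecewisePoly (M : Finset (Finset Plane)) (r : ℕ) (v : Plane → ℝ) : Prop :=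
  ∀ t ∈ M, ∃ q : MvPolynomial (Fin 2) ℝ, q.totalDegree ≤ r ∧
    ∀ x ∈ convexHull ℝ (t : Set Plane), v x = MvPolynomial.eval (fun j => x j) q

/-- Continuous functions on `closure Ω`, piecewise polynomial of degree at most `r` with respect
to `M`. A function on `closure Ω` is represented by its extension by zero to the plane. -/
def lagrangeSpace (Ω : Set Plane) (M : Finset (Finset Plane)) (r : ℕ) :
    Submodule ℝ (Plane → ℝ) where
  carrier := {v | ContinuousOn v (closure Ω) ∧ (∀ x, x ∉ closure Ω → v x = 0) ∧
    IsPiecewisePoly M r v}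
  zero_mem' := ⟨continuousOn_const, fun _ _ => rfl, fun _ _ => ⟨0, by simp, by simp⟩⟩
  add_mem' := by
    rintro v w ⟨hv1, hv2, hv3⟩ ⟨hw1, hw2, hw3⟩
    refine ⟨hv1.add hw1, fun x hx => by simp [hv2 x hx, hw2 x hx], fun t ht => ?_⟩
    obtain ⟨q, hq, hq'⟩ := hv3 t ht
    obtain ⟨s, hs, hs'⟩ := hw3 t ht
    exact ⟨q + s, (MvPolynomial.totalDegree_add q s).trans (max_le hq hs),
      fun x hx => by simp [hq' x hx, hs' x hx]⟩
  smul_mem' := by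
    rintro c v ⟨hv1, hv2, hv3⟩
    refine ⟨hv1.const_smul c, fun x hx => by simp [hv2 x hx], fun t ht => ?_⟩
    obtain ⟨q, hq, hq'⟩ := hv3 t ht
    exact ⟨c • q, (MvPolynomial.totalDegree_smul_le c q).trans hq,
      fun x hx => by simp [hq' x hx, MvPolynomial.smul_eval]⟩

/-- The Taylor–Hood velocity space: continuous piecewise quadratic vector fields that vanish on
the boundary of `Ω`. -/
def velocitySpace (Ω : Set Plane) (M : Finset (Finset Plane)) : Submodule ℝ (Plane → Plane) where
  carrier := {u | (∀ i, (fun x => u x i) ∈ lagrangeSpace Ω M 2) ∧ ∀ x ∈ frontier Ω, u x = 0}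
  zero_mem' := ⟨fun _ => (lagrangeSpace Ω M 2).zero_mem, fun _ _ => rfl⟩
  add_mem' := by
    rintro u w ⟨hu, hu'⟩ ⟨hw, hw'⟩
    exact ⟨fun i => (lagrangeSpace Ω M 2).add_mem (hu i) (hw i),
      fun x hx => by simp [hu' x hx, hw' x hx]⟩
  smul_mem' := by
    rintro c u ⟨hu, hu'⟩
    exact ⟨fun i => (lagrangeSpace Ω M 2).smul_mem c (hu i), fun x hx => by simp [hu' x hx]⟩

/-- The Taylor–Hood pressure space: continuous piecewise affine functions with mean value zero.
(Integrability is automatic for bounded `Ω`.) -/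
def pressureSpace (Ω : Set Plane) (M : Finset (Finset Plane)) : Submodule ℝ (Plane → ℝ) where
  carrier := {p | p ∈ lagrangeSpace Ω M 1 ∧ IntegrableOn p Ω ∧ ∫ x in Ω, p x = 0}
  zero_mem' := ⟨(lagrangeSpace Ω M 1).zero_mem, integrable_zero _ _ _, by simp⟩
  add_mem' := by
    rintro p q ⟨hp, hpi, hp0⟩ ⟨hq, hqi, hq0⟩
    refine ⟨(lagrangeSpace Ω M 1).add_mem hp hq, hpi.add hqi, ?_⟩
    simp only [Pi.add_apply]
    rw [integral_add hpi hqi, hp0, hq0, add_zero]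
  smul_mem' := by
    rintro c p ⟨hp, hpi, hp0⟩
    refine ⟨(lagrangeSpace Ω M 1).smul_mem c hp, hpi.smul c, ?_⟩
    simp only [Pi.smul_apply]
    rw [integral_smul, hp0, smul_zero]

namespace Triangulation

variable {Ω : Set Plane}

open Classical in
/-- The set of triangles on grid level `k`, obtained by `k` uniform refinements. -/
def level (T : Triangulation Ω) : ℕ → Finset (Finset Plane)
  | 0 => T.triangles
  | k + 1 => (T.level k).biUnion refineTriangle

/-- The grid size `h_k`: the length of the largest edge on level `k`. -/
def gridSize (T : Triangulation Ω) (k : ℕ) : ℝ :=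
  (((T.level k).sup fun t => (t ×ˢ t).sup fun e => nndist e.1 e.2 : ℝ≥0) : ℝ)

/-- `U_k`. -/
abbrev velocity (T : Triangulation Ω) (k : ℕ) : Submodule ℝ (Plane → Plane) :=
  velocitySpace Ω (T.level k)

/-- `P_k`. -/
abbrev pressure (T : Triangulation Ω) (k : ℕ) : Submodule ℝ (Plane → ℝ) :=
  pressureSpace Ω (T.level k)

/-- `X_k = U_k × P_k`. -/
abbrev mixed (T : Triangulation Ω) (k : ℕ) : Type := T.velocity k × T.pressure k

/-- `𝓑((u, p), (u', p')) = (∇ u, ∇ u') + β (u, u') + (p, ∇ · u') + (∇ · u, p')`. -/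
def mixedForm (T : Triangulation Ω) (k : ℕ) (β : ℝ) (x y : T.mixed k) : ℝ :=
  aForm Ω β x.1 y.1 + bForm Ω y.1 x.2 + bForm Ω x.1 y.2

end Triangulation

/-! ### Matrices, norm and smoother -/

/-- One step of the Uzawa type smoother for the system with blocks `A`, `Bᵀ`, `B`, `0`, right-hand
side `(f, g)`, preconditioners `Ahat`, `Shat` and damping parameters `τ`, `σ`. -/
def uzawaStep {ι κ : Type} [Fintype ι] [DecidableEq ι] [Fintype κ] [DecidableEq κ]
    (A : Matrix ι ι ℝ) (B : Matrix κ ι ℝ) (Ahat : Matrix ι ι ℝ) (Shat : Matrix κ κ ℝ) (τ σ : ℝ)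
    (f : ι → ℝ) (g : κ → ℝ) (x : (ι → ℝ) × (κ → ℝ)) : (ι → ℝ) × (κ → ℝ) :=
  let uHalf := x.1 + τ • (Ahat⁻¹ *ᵥ (f - A *ᵥ x.1 - Bᵀ *ᵥ x.2))
  let p := x.2 - σ • (Shat⁻¹ *ᵥ (g - B *ᵥ uHalf))
  let u := x.1 + τ • (Ahat⁻¹ *ᵥ (f - A *ᵥ x.1 - Bᵀ *ᵥ p))
  (u, p)

/-- A choice of bases of the Taylor–Hood spaces on level `k`, used to pass to matrix-vector
notation. -/
structure MixedBasis {Ω : Set Plane} (T : Triangulation Ω) (k : ℕ) where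
  n : ℕ
  m : ℕ
  φ : Module.Basis (Fin n) ℝ (T.velocity k)
  ψ : Module.Basis (Fin m) ℝ (T.pressure k)

namespace MixedBasis

variable {Ω : Set Plane} {T : Triangulation Ω} {k : ℕ}

/-- `A_k`, representing `a`. -/
def A (D : MixedBasis T k) (β : ℝ) : Matrix (Fin D.n) (Fin D.n) ℝ :=
  Matrix.of fun i j => aForm Ω β (D.φ j) (D.φ i)

/-- `B_k`, representing `b`. -/
def B (D : MixedBasis T k) : Matrix (Fin D.m) (Fin D.n) ℝ :=
  Matrix.of fun i j => bForm Ω (D.φ j) (D.ψ i)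

/-- The mass matrix `M_{U,k}`. -/
def massU (D : MixedBasis T k) : Matrix (Fin D.n) (Fin D.n) ℝ :=
  Matrix.of fun i j => vecInner Ω (D.φ j) (D.φ i)

/-- The mass matrix `M_{P,k}`. -/
def massP (D : MixedBasis T k) : Matrix (Fin D.m) (Fin D.m) ℝ :=
  Matrix.of fun i j => scalInner Ω (D.ψ j) (D.ψ i)

/-- `Â_k = (h_k⁻² + β) M_{U,k}`. -/
def Ahat (D : MixedBasis T k) (β : ℝ) : Matrix (Fin D.n) (Fin D.n) ℝ :=
  ((T.gridSize k ^ 2)⁻¹ + β) • D.massU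

/-- `Ŝ_k = h_k⁻² (β + h_k⁻²)⁻¹ M_{P,k}`. -/
def Shat (D : MixedBasis T k) (β : ℝ) : Matrix (Fin D.m) (Fin D.m) ℝ :=
  ((T.gridSize k ^ 2)⁻¹ * (β + (T.gridSize k ^ 2)⁻¹)⁻¹) • D.massP

/-- The block diagonal matrix `𝓛_k` with diagonal blocks `Â_k` and `Ŝ_k`. -/
def L (D : MixedBasis T k) (β : ℝ) :
    Matrix (Fin D.n ⊕ Fin D.m) (Fin D.n ⊕ Fin D.m) ℝ :=
  Matrix.fromBlocks (D.Ahat β) 0 0 (D.Shat β)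

/-- The coefficient vectors of an element of `X_k`. -/
def coords (D : MixedBasis T k) : T.mixed k ≃ₗ[ℝ] (Fin D.n → ℝ) × (Fin D.m → ℝ) :=
  D.φ.equivFun.prodCongr D.ψ.equivFun

/-- `|||x|||_k`, the norm defined by `𝓛_k`. -/
def tripleNorm (D : MixedBasis T k) (β : ℝ) (x : T.mixed k) : ℝ :=
  let v := Sum.elim (D.coords x).1 (D.coords x).2
  √((D.L β *ᵥ v) ⬝ᵥ v)

/-- The result of `ν` steps of the Uzawa type smoother on level `k`, started at `x₀`, for the
right-hand side `F`. -/
def smooth (D : MixedBasis T k) (β τ σ : ℝ) (F : T.mixed k →ₗ[ℝ] ℝ) (ν : ℕ) (x₀ : T.mixed k) :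
    T.mixed k :=
  D.coords.symm ((uzawaStep (D.A β) D.B (D.Ahat β) (D.Shat β) τ σ
    (fun i => F (D.φ i, 0)) (fun j => F (0, D.ψ j)))^[ν] (D.coords x₀))

/-- `τ⁻¹ Â_k ≥ A_k` and `σ⁻¹ Ŝ_k ≥ τ B_k Â_k⁻¹ B_kᵀ`, in the sense of the order of symmetric
matrices. -/
def DampingCondition (D : MixedBasis T k) (β τ σ : ℝ) : Prop :=
  (τ⁻¹ • D.Ahat β - D.A β).PosSemidef ∧
  (σ⁻¹ • D.Shat β - τ • (D.B * (D.Ahat β)⁻¹ * (D.B)ᵀ)).PosSemidef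

/-- The smoothing property with rate `η` for the Uzawa type smoother: for every right-hand side
`F`, every Galerkin solution `xs` and every initial value `x₀`,
`sup_y 𝓑(x_ν - xs, y) / |||y|||_k ≤ η(ν) |||x₀ - xs|||_k` for all `ν ≥ 1`, the supremum being over
`y ≠ 0`; and `η(ν) → 0`. -/
def SmoothingProperty (D : MixedBasis T k) (β τ σ : ℝ) (η : ℕ → ℝ) : Prop :=
  (∀ (F : T.mixed k →ₗ[ℝ] ℝ) (xs x₀ : T.mixed k),
    (∀ y, T.mixedForm k β xs y = F y) →
    ∀ ν : ℕ, 1 ≤ ν → ∀ y : T.mixed k, y ≠ 0 →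
      T.mixedForm k β (D.smooth β τ σ F ν x₀ - xs) y / D.tripleNorm β y
        ≤ η ν * D.tripleNorm β (x₀ - xs)) ∧
  Filter.Tendsto η Filter.atTop (nhds 0)

end MixedBasis

end Stokes

end

/-! Smoothing. One Uzawa step is an implicit iteration for the error `e`. With the block diagonal
matrix Q = diag(τ⁻¹Â - A, σ⁻¹Ŝ - τBÂ⁻¹Bᵀ) and N = Q + K, where K has the rows (A, Bᵀ) and (-B, 0),
it reads N e⁺ = Q e. Condition (1) says exactly that Q is positive semidefinite. The off-diagonal
blocks of K are skew and A ≥ 0, so zᵀNz ≥ zᵀQz; hence the step is firmly nonexpansive in the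
seminorm of Q.

For such an iteration the increments d_i = e_i - e_{i+1} decrease and their squares telescope, so
(m+1)|d_m|² ≤ |e_0|². On the other hand K e_{m+1} = Q d_m, and K is the saddle point matrix up to
the sign of its second row. The residual after ν = m+1 steps is therefore a Q-pairing with d_m, and
Cauchy–Schwarz gives the rate ν^(-1/2). Since Q ≤ max(τ⁻¹, σ⁻¹) 𝓛, the constant is max(τ⁻¹, σ⁻¹).
This is `Matrix.PosSemidef.increment_pairing_le` and `Stokes.uzawa_smoothing`.

Damping. Condition (1) reduces to an inverse inequality ‖∂_j u_i‖² ≤ C h_k⁻² ‖u_i‖² with C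
independent of k (`exists_inverse_inequality`). Every triangle of level k is the image of an initial
triangle under x ↦ a + r x with |r| = 2⁻ᵏ, so only finitely many reference shapes occur. On each of
them the inequality for quadratics is a finite-dimensional fact, and scaling supplies the power of
h_k. -/

noncomputable section

/-! ### Firmly nonexpansive iterations in a positive semidefinite seminorm -/

namespace Matrix

variable {ι κ : Type*} [Fintype ι] [Fintype κ]

theorem PosSemidef.dotProduct_mulVec_self_nonneg {Q : Matrix ι ι ℝ} (hQ : Q.PosSemidef)
    (w : ι → ℝ) : 0 ≤ w ⬝ᵥ (Q *ᵥ w) := by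
  simpa using hQ.dotProduct_mulVec_nonneg w

theorem IsHermitian.dotProduct_mulVec_swap {Q : Matrix ι ι ℝ} (hQ : Q.IsHermitian)
    (w z : ι → ℝ) : w ⬝ᵥ (Q *ᵥ z) = z ⬝ᵥ (Q *ᵥ w) := by
  have h : Qᵀ = Q := by simpa using hQ.eq
  rw [dotProduct_comm, ← vecMul_transpose, h, ← dotProduct_mulVec]

/-- The Cauchy–Schwarz inequality for the semi-inner product of a positive semidefinite matrix. -/
theorem PosSemidef.sq_dotProduct_mulVec_le {Q : Matrix ι ι ℝ} (hQ : Q.PosSemidef)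
    (w z : ι → ℝ) : (w ⬝ᵥ (Q *ᵥ z)) ^ 2 ≤ (w ⬝ᵥ (Q *ᵥ w)) * (z ⬝ᵥ (Q *ᵥ z)) := by
  -- The quadratic in t is the squared seminorm of w + t z; nonnegativity forces its discriminant to
  -- be at most 0.
  have h : ∀ t : ℝ, 0 ≤ (z ⬝ᵥ (Q *ᵥ z)) * (t * t) + (2 * (w ⬝ᵥ (Q *ᵥ z))) * t
      + w ⬝ᵥ (Q *ᵥ w) := fun t => by
    have := hQ.dotProduct_mulVec_self_nonneg (w + t • z)
    simp only [mulVec_add, mulVec_smul, dotProduct_add, add_dotProduct, smul_dotProduct,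
      dotProduct_smul, smul_eq_mul, hQ.1.dotProduct_mulVec_swap z w] at this
    linarith
  have := discrim_le_zero h
  unfold discrim at this
  linarith

section Iteration

variable {Q N : Matrix ι ι ℝ} {e : ℕ → ι → ℝ}

/-- Expand the square: the cross term is zᵀQw = zᵀNz, which is at least zᵀQz. -/
theorem PosSemidef.firmlyNonexpansive (hQ : Q.PosSemidef)
    (hN : ∀ w, w ⬝ᵥ (Q *ᵥ w) ≤ w ⬝ᵥ (N *ᵥ w)) {w z : ι → ℝ} (h : N *ᵥ z = Q *ᵥ w) :
    (w - z) ⬝ᵥ (Q *ᵥ (w - z)) ≤ w ⬝ᵥ (Q *ᵥ w) - z ⬝ᵥ (Q *ᵥ z) := by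
  have := hN z
  rw [h] at this
  simp only [mulVec_sub, sub_dotProduct, dotProduct_sub, hQ.1.dotProduct_mulVec_swap w z]
  linarith

/-- Summing firm nonexpansiveness over the steps telescopes the squared increments. The increments
obey the same recursion, so they are monotone and the last one is the smallest of the m + 1
summands. -/
theorem PosSemidef.mul_increment_le (hQ : Q.PosSemidef)
    (hN : ∀ w, w ⬝ᵥ (Q *ᵥ w) ≤ w ⬝ᵥ (N *ᵥ w)) (h : ∀ i, N *ᵥ e (i + 1) = Q *ᵥ e i) (m : ℕ) :
    ((m : ℝ) + 1) * ((e m - e (m + 1)) ⬝ᵥ (Q *ᵥ (e m - e (m + 1))))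
      ≤ e 0 ⬝ᵥ (Q *ᵥ e 0) - e (m + 1) ⬝ᵥ (Q *ᵥ e (m + 1)) := by
  induction m with
  | zero => simpa using hQ.firmlyNonexpansive hN (h 0)
  | succ m ih =>
    have h1 := hQ.firmlyNonexpansive hN (h (m + 1))
    -- Applied to consecutive increments; with `h3` it gives their monotonicity.
    have h2 := hQ.firmlyNonexpansive hN (w := e m - e (m + 1)) (z := e (m + 1) - e (m + 1 + 1))
      (by rw [mulVec_sub, mulVec_sub, h, h])
    have h3 := hQ.dotProduct_mulVec_self_nonneg (e m - e (m + 1) - (e (m + 1) - e (m + 1 + 1)))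
    have h4 : 0 ≤ (m : ℝ) + 1 := by positivity
    push_cast
    nlinarith [mul_le_mul_of_nonneg_left (h3.trans h2) h4]

theorem PosSemidef.increment_pairing_le (hQ : Q.PosSemidef)
    (hN : ∀ w, w ⬝ᵥ (Q *ᵥ w) ≤ w ⬝ᵥ (N *ᵥ w)) (h : ∀ i, N *ᵥ e (i + 1) = Q *ᵥ e i) (m : ℕ)
    (y : ι → ℝ) :
    y ⬝ᵥ (Q *ᵥ (e m - e (m + 1)))
      ≤ √(y ⬝ᵥ (Q *ᵥ y)) * (((m + 1 : ℕ) : ℝ) ^ (-(1 / 2) : ℝ) * √(e 0 ⬝ᵥ (Q *ᵥ e 0))) := by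
  have h1 := hQ.sq_dotProduct_mulVec_le y (e m - e (m + 1))
  have h2 := hQ.mul_increment_le hN h m
  have h3 := hQ.dotProduct_mulVec_self_nonneg (e (m + 1))
  have hm : (0 : ℝ) < (m : ℝ) + 1 := by positivity
  have h4 : (e m - e (m + 1)) ⬝ᵥ (Q *ᵥ (e m - e (m + 1)))
      ≤ ((m : ℝ) + 1)⁻¹ * (e 0 ⬝ᵥ (Q *ᵥ e 0)) := by
    rw [inv_mul_eq_div, le_div_iff₀ hm]
    linarith
  have h5 : (((m + 1 : ℕ) : ℝ) ^ (-(1 / 2) : ℝ)) = √(((m : ℝ) + 1)⁻¹) := by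
    rw [Real.rpow_neg (by positivity), ← Real.sqrt_eq_rpow, Real.sqrt_inv]
    push_cast
    rfl
  have h6 := hQ.dotProduct_mulVec_self_nonneg y
  rw [h5, ← Real.sqrt_mul (by positivity), ← Real.sqrt_mul h6]
  exact Real.le_sqrt_of_sq_le (h1.trans (mul_le_mul_of_nonneg_left h4 h6))

end Iteration

end Matrix

/-! ### The Uzawa step as an implicit iteration, and its smoothing property -/

namespace Stokes

section Uzawa

variable {ι κ : Type} [Fintype ι] [DecidableEq ι] [Fintype κ] [DecidableEq κ]
  {A Ahat : Matrix ι ι ℝ} {B : Matrix κ ι ℝ} {Shat : Matrix κ κ ℝ} {τ σ : ℝ}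
  {f : ι → ℝ} {g : κ → ℝ}

/-- The error propagation of the velocity component. -/
theorem uzawaStep_fst_error (hA : IsUnit Ahat.det) (hτ : τ ≠ 0) {us : ι → ℝ} {ps : κ → ℝ}
    (hf : A *ᵥ us + Bᵀ *ᵥ ps = f) (x : (ι → ℝ) × (κ → ℝ)) :
    let x' := uzawaStep A B Ahat Shat τ σ f g x
    (τ⁻¹ • Ahat) *ᵥ (x'.1 - us) + Bᵀ *ᵥ (x'.2 - ps) = (τ⁻¹ • Ahat - A) *ᵥ (x.1 - us) := by
  intro x'
  have h1 : (τ⁻¹ • Ahat) *ᵥ (x'.1 - x.1) = f - A *ᵥ x.1 - Bᵀ *ᵥ x'.2 := by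
    have : x'.1 - x.1 = τ • (Ahat⁻¹ *ᵥ (f - A *ᵥ x.1 - Bᵀ *ᵥ x'.2)) := by
      simp [x', uzawaStep]
    rw [this, Matrix.smul_mulVec, Matrix.mulVec_smul, smul_smul, inv_mul_cancel₀ hτ, one_smul,
      Matrix.mulVec_mulVec, Matrix.mul_nonsing_inv _ hA, Matrix.one_mulVec]
  rw [← hf] at h1
  simp only [Matrix.mulVec_sub, Matrix.sub_mulVec] at h1 ⊢
  rw [sub_eq_iff_eq_add] at h1
  rw [h1]
  abel

/-- The error propagation of the pressure component. -/
theorem uzawaStep_snd_error (hS : IsUnit Shat.det) (hσ : σ ≠ 0) {us : ι → ℝ} (ps : κ → ℝ)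
    (hg : B *ᵥ us = g) (x : (ι → ℝ) × (κ → ℝ)) :
    let x' := uzawaStep A B Ahat Shat τ σ f g x
    (-B) *ᵥ (x'.1 - us) + (σ⁻¹ • Shat - τ • (B * Ahat⁻¹ * Bᵀ)) *ᵥ (x'.2 - ps)
      = (σ⁻¹ • Shat - τ • (B * Ahat⁻¹ * Bᵀ)) *ᵥ (x.2 - ps) := by
  intro x'
  have h1 : (σ⁻¹ • Shat) *ᵥ (x'.2 - x.2)
      = B *ᵥ (x.1 + τ • (Ahat⁻¹ *ᵥ (f - A *ᵥ x.1 - Bᵀ *ᵥ x.2))) - g := by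
    have : x'.2 - x.2 = -(σ • (Shat⁻¹ *ᵥ (g - B *ᵥ (x.1 + τ • (Ahat⁻¹ *ᵥ
        (f - A *ᵥ x.1 - Bᵀ *ᵥ x.2)))))) := by
      simp [x', uzawaStep]
    rw [this, Matrix.smul_mulVec, Matrix.mulVec_neg, Matrix.mulVec_smul, smul_neg, smul_smul,
      inv_mul_cancel₀ hσ, one_smul, Matrix.mulVec_mulVec, Matrix.mul_nonsing_inv _ hS,
      Matrix.one_mulVec]
    abel
  -- The half step differs from the final velocity only through the pressure used. Eliminating it
  -- produces the Schur complement term τBÂ⁻¹Bᵀ.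
  have h2 : x.1 + τ • (Ahat⁻¹ *ᵥ (f - A *ᵥ x.1 - Bᵀ *ᵥ x.2))
      = x'.1 + τ • (Ahat⁻¹ *ᵥ (Bᵀ *ᵥ (x'.2 - x.2))) := by
    have : x'.1 = x.1 + τ • (Ahat⁻¹ *ᵥ (f - A *ᵥ x.1 - Bᵀ *ᵥ x'.2)) := by simp [x', uzawaStep]
    rw [this, add_assoc, ← smul_add, ← Matrix.mulVec_add, Matrix.mulVec_sub Bᵀ]
    congr 4
    abel
  have h3 : (τ • (B * Ahat⁻¹ * Bᵀ)) *ᵥ (x'.2 - x.2)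
      = B *ᵥ (τ • (Ahat⁻¹ *ᵥ (Bᵀ *ᵥ (x'.2 - x.2)))) := by
    simp only [Matrix.smul_mulVec, Matrix.mulVec_smul, Matrix.mulVec_mulVec, Matrix.mul_assoc]
  rw [h2, Matrix.mulVec_add, ← h3, ← hg] at h1
  have h4 : (σ⁻¹ • Shat - τ • (B * Ahat⁻¹ * Bᵀ)) *ᵥ (x'.2 - x.2) = B *ᵥ (x'.1 - us) := by
    rw [Matrix.sub_mulVec, h1, Matrix.mulVec_sub B]
    abel
  have h5 : x'.2 - ps = (x'.2 - x.2) + (x.2 - ps) := by abel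
  rw [h5, Matrix.mulVec_add, h4, Matrix.neg_mulVec]
  abel

/-- The smoothing property of the Uzawa type smoother in matrix-vector notation. -/
theorem uzawa_smoothing (hAhat : Ahat.PosDef) (hShat : Shat.PosDef) (hApos : A.PosSemidef)
    (hτ : 0 < τ) (hσ : 0 < σ) (h1 : (τ⁻¹ • Ahat - A).PosSemidef)
    (h2 : (σ⁻¹ • Shat - τ • (B * Ahat⁻¹ * Bᵀ)).PosSemidef)
    {us : ι → ℝ} {ps : κ → ℝ} (hf : A *ᵥ us + Bᵀ *ᵥ ps = f) (hg : B *ᵥ us = g)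
    (x₀ : (ι → ℝ) × (κ → ℝ)) {ν : ℕ} (hν : 1 ≤ ν) (v : ι → ℝ) (q : κ → ℝ) :
    let x := (uzawaStep A B Ahat Shat τ σ f g)^[ν] x₀
    let n : (ι → ℝ) → (κ → ℝ) → ℝ := fun u p =>
      √((Matrix.fromBlocks Ahat 0 0 Shat *ᵥ Sum.elim u p) ⬝ᵥ Sum.elim u p)
    v ⬝ᵥ (A *ᵥ (x.1 - us) + Bᵀ *ᵥ (x.2 - ps)) + q ⬝ᵥ (B *ᵥ (x.1 - us))
      ≤ max τ⁻¹ σ⁻¹ * (ν : ℝ) ^ (-(1 / 2) : ℝ) * n (x₀.1 - us) (x₀.2 - ps) * n v q := by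
  intro x n
  obtain ⟨m, rfl⟩ : ∃ m, ν = m + 1 := ⟨ν - 1, by omega⟩
  set Q1 := τ⁻¹ • Ahat - A with hQ1
  set Q2 := σ⁻¹ • Shat - τ • (B * Ahat⁻¹ * Bᵀ) with hQ2
  set Q : Matrix (ι ⊕ κ) (ι ⊕ κ) ℝ := Matrix.fromBlocks Q1 0 0 Q2 with hQdef
  set N : Matrix (ι ⊕ κ) (ι ⊕ κ) ℝ := Matrix.fromBlocks (τ⁻¹ • Ahat) Bᵀ (-B) Q2 with hNdef
  have hQe : ∀ (u v : ι → ℝ) (p q : κ → ℝ), Sum.elim v q ⬝ᵥ (Q *ᵥ Sum.elim u p)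
      = v ⬝ᵥ (Q1 *ᵥ u) + q ⬝ᵥ (Q2 *ᵥ p) := fun u v p q => by
    simp [hQdef, Matrix.fromBlocks_mulVec]
  have hsum : ∀ w : ι ⊕ κ → ℝ, ∃ u p, w = Sum.elim u p := fun w =>
    ⟨w ∘ Sum.inl, w ∘ Sum.inr, (Sum.elim_comp_inl_inr w).symm⟩
  have hQ : Q.PosSemidef := by
    refine .of_dotProduct_mulVec_nonneg ?_ fun w => ?_
    · exact Matrix.IsHermitian.fromBlocks h1.1 (by simp) h2.1
    · obtain ⟨u, p, rfl⟩ := hsum w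
      rw [star_trivial, hQe]
      exact add_nonneg (h1.dotProduct_mulVec_self_nonneg u) (h2.dotProduct_mulVec_self_nonneg p)
  -- The blocks Bᵀ and -B cancel in the quadratic form, and what remains of N - Q is uᵀAu ≥ 0.
  have hN : ∀ w, w ⬝ᵥ (Q *ᵥ w) ≤ w ⬝ᵥ (N *ᵥ w) := fun w => by
    obtain ⟨u, p, rfl⟩ := hsum w
    have hA := hApos.dotProduct_mulVec_self_nonneg u
    have hB : u ⬝ᵥ (Bᵀ *ᵥ p) = p ⬝ᵥ (B *ᵥ u) := by
      rw [Matrix.mulVec_transpose, dotProduct_comm, ← Matrix.dotProduct_mulVec]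
    rw [hQe]
    simp only [hNdef, Matrix.fromBlocks_mulVec, hQ1, Matrix.sub_mulVec, dotProduct_sub,
      Sum.elim_comp_inl, Sum.elim_comp_inr, sumElim_dotProduct_sumElim, dotProduct_add,
      hB, Matrix.neg_mulVec, dotProduct_neg]
    linarith
  -- Q arises from diag(τ⁻¹Â, σ⁻¹Ŝ) by subtracting the nonnegative terms A and τBÂ⁻¹Bᵀ.
  have hQle : ∀ (u : ι → ℝ) (p : κ → ℝ), √(Sum.elim u p ⬝ᵥ (Q *ᵥ Sum.elim u p))
      ≤ √(max τ⁻¹ σ⁻¹) * n u p := fun u p => by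
    rw [← Real.sqrt_mul (by positivity)]
    refine Real.sqrt_le_sqrt ?_
    have hA := hApos.dotProduct_mulVec_self_nonneg u
    have hAh := hAhat.posSemidef.dotProduct_mulVec_self_nonneg u
    have hSh := hShat.posSemidef.dotProduct_mulVec_self_nonneg p
    have hBA : 0 ≤ p ⬝ᵥ ((B * Ahat⁻¹ * Bᵀ) *ᵥ p) := by
      have := hAhat.inv.posSemidef.mul_mul_conjTranspose_same B
      simpa using this.dotProduct_mulVec_nonneg p
    have e1 : (Matrix.fromBlocks Ahat 0 0 Shat *ᵥ Sum.elim u p) ⬝ᵥ Sum.elim u p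
        = u ⬝ᵥ (Ahat *ᵥ u) + p ⬝ᵥ (Shat *ᵥ p) := by
      rw [dotProduct_comm]
      simp [Matrix.fromBlocks_mulVec]
    rw [hQe, e1, hQ1, hQ2]
    simp only [Matrix.sub_mulVec, Matrix.smul_mulVec, dotProduct_sub, dotProduct_smul, smul_eq_mul]
    have e2 := mul_le_mul_of_nonneg_right (le_max_left τ⁻¹ σ⁻¹) hAh
    have e3 := mul_le_mul_of_nonneg_right (le_max_right τ⁻¹ σ⁻¹) hSh
    have e4 := mul_nonneg hτ.le hBA
    linarith
  set X : ℕ → (ι → ℝ) × (κ → ℝ) := fun i => (uzawaStep A B Ahat Shat τ σ f g)^[i] x₀ with hX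
  set e : ℕ → ι ⊕ κ → ℝ := fun i => Sum.elim ((X i).1 - us) ((X i).2 - ps) with he
  have hA := (Matrix.isUnit_iff_isUnit_det _).1 hAhat.isUnit
  have hS := (Matrix.isUnit_iff_isUnit_det _).1 hShat.isUnit
  have hXs : ∀ i, X (i + 1) = uzawaStep A B Ahat Shat τ σ f g (X i) := fun i =>
    Function.iterate_succ_apply' _ _ _
  have k1 : ∀ i, (τ⁻¹ • Ahat) *ᵥ ((X (i + 1)).1 - us) + Bᵀ *ᵥ ((X (i + 1)).2 - ps)
      = Q1 *ᵥ ((X i).1 - us) := fun i => by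
    rw [hXs]; exact uzawaStep_fst_error hA hτ.ne' hf _
  have k2 : ∀ i, (-B) *ᵥ ((X (i + 1)).1 - us) + Q2 *ᵥ ((X (i + 1)).2 - ps)
      = Q2 *ᵥ ((X i).2 - ps) := fun i => by
    rw [hXs]; exact uzawaStep_snd_error hS hσ.ne' ps hg _
  have hrec : ∀ i, N *ᵥ e (i + 1) = Q *ᵥ e i := fun i => by
    simp only [he, hNdef, hQdef, Matrix.fromBlocks_mulVec, Sum.elim_comp_inl, Sum.elim_comp_inr,
      Matrix.zero_mulVec, add_zero, zero_add, k1, k2]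
  -- The test vector carries -q because the second row of N contains -B; the block diagonal
  -- quadratic form does not see this sign.
  have key := hQ.increment_pairing_le hN hrec m (Sum.elim v (-q))
  have hd : e m - e (m + 1) = Sum.elim ((X m).1 - (X (m + 1)).1) ((X m).2 - (X (m + 1)).2) := by
    ext (i | i) <;> simp [he]
  have hneg : √(Sum.elim v (-q) ⬝ᵥ (Q *ᵥ Sum.elim v (-q))) ≤ √(max τ⁻¹ σ⁻¹) * n v q := by
    have := hQle v q
    rw [hQe] at this
    rw [hQe]
    simpa [Matrix.mulVec_neg] using this
  rw [hd, hQe] at key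
  have l1 : A *ᵥ ((X (m + 1)).1 - us) + Bᵀ *ᵥ ((X (m + 1)).2 - ps)
      = Q1 *ᵥ ((X m).1 - (X (m + 1)).1) := by
    have : (X m).1 - (X (m + 1)).1 = ((X m).1 - us) - ((X (m + 1)).1 - us) := by abel
    rw [this, Matrix.mulVec_sub Q1, ← k1, hQ1, Matrix.sub_mulVec]
    abel
  have l2 : B *ᵥ ((X (m + 1)).1 - us) = -(Q2 *ᵥ ((X m).2 - (X (m + 1)).2)) := by
    have : (X m).2 - (X (m + 1)).2 = ((X m).2 - ps) - ((X (m + 1)).2 - ps) := by abel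
    rw [this, Matrix.mulVec_sub Q2, ← k2, Matrix.neg_mulVec]
    abel
  have l3 : v ⬝ᵥ (A *ᵥ (x.1 - us) + Bᵀ *ᵥ (x.2 - ps)) + q ⬝ᵥ (B *ᵥ (x.1 - us))
      = v ⬝ᵥ (Q1 *ᵥ ((X m).1 - (X (m + 1)).1)) + (-q) ⬝ᵥ (Q2 *ᵥ ((X m).2 - (X (m + 1)).2)) := by
    change v ⬝ᵥ (A *ᵥ ((X (m + 1)).1 - us) + Bᵀ *ᵥ ((X (m + 1)).2 - ps))
      + q ⬝ᵥ (B *ᵥ ((X (m + 1)).1 - us)) = _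
    rw [l1, l2, dotProduct_neg, neg_dotProduct]
  rw [l3]
  refine key.trans ?_
  have h0 := hQle (x₀.1 - us) (x₀.2 - ps)
  have hn : ∀ u p, 0 ≤ n u p := fun u p => Real.sqrt_nonneg _
  have hr : (0 : ℝ) ≤ ((m + 1 : ℕ) : ℝ) ^ (-(1 / 2) : ℝ) := by positivity
  calc _ ≤ (√(max τ⁻¹ σ⁻¹) * n v q) * (((m + 1 : ℕ) : ℝ) ^ (-(1 / 2) : ℝ)
        * (√(max τ⁻¹ σ⁻¹) * n (x₀.1 - us) (x₀.2 - ps))) :=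
        mul_le_mul hneg (mul_le_mul_of_nonneg_left h0 hr) (by positivity)
          (mul_nonneg (Real.sqrt_nonneg _) (hn _ _))
    _ = (√(max τ⁻¹ σ⁻¹) * √(max τ⁻¹ σ⁻¹)) * ((m + 1 : ℕ) : ℝ) ^ (-(1 / 2) : ℝ)
        * n (x₀.1 - us) (x₀.2 - ps) * n v q := by ring
    _ = _ := by rw [Real.mul_self_sqrt (by positivity)]

end Uzawa

end Stokes

/-! ### Geometry of one uniform refinement -/

theorem Finset.sum_biUnion_le_sum {α β : Type*} [DecidableEq β] (s : Finset α) (t : α → Finset β)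
    (f : β → ENNReal) : ∑ b ∈ s.biUnion t, f b ≤ ∑ a ∈ s, ∑ b ∈ t a, f b := by
  classical
  induction s using Finset.induction_on with
  | empty => simp
  | insert a s ha ih =>
    rw [Finset.biUnion_insert, Finset.sum_insert ha]
    calc _ ≤ ∑ b ∈ t a ∪ s.biUnion t, f b + ∑ b ∈ t a ∩ s.biUnion t, f b := le_self_add
      _ = ∑ b ∈ t a, f b + ∑ b ∈ s.biUnion t, f b := Finset.sum_union_inter
      _ ≤ _ := by gcongr

namespace Stokes

section AffineImage

open scoped Pointwise

theorem convexHull_image_add_smul (a : Plane) (r : ℝ) (S : Set Plane) :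
    convexHull ℝ ((fun x => a + r • x) '' S) = (fun x => a + r • x) '' convexHull ℝ S := by
  have h := AffineMap.image_convexHull
    (AffineMap.const ℝ Plane a + r • AffineMap.id ℝ Plane) S
  exact h.symm

theorem volume_image_add_smul (a : Plane) (r : ℝ) (S : Set Plane) :
    volume ((fun x => a + r • x) '' S) = ENNReal.ofReal (r ^ 2) * volume S := by
  have : (fun x => a + r • x) '' S = (fun x => a + x) '' (r • S) := by
    rw [← Set.image_smul, Set.image_image]
  rw [this, Set.image_add_left, measure_preimage_add, Measure.addHaar_smul]
  simp

theorem setIntegral_image_add_smul (a : Plane) {r : ℝ} (hr : r ≠ 0) (S : Set Plane)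
    (f : Plane → ℝ) :
    ∫ x in (fun x => a + r • x) '' S, f x = r ^ 2 * ∫ x in S, f (a + r • x) := by
  have h1 := Measure.setIntegral_comp_smul volume (fun x => f (a + x)) S hr
  have h2 : (fun x => a + r • x) '' S = (fun x => a + x) '' (r • S) := by
    rw [← Set.image_smul, Set.image_image]
  have h3 : ∫ x in (fun x => a + x) '' (r • S), f x = ∫ x in r • S, f (a + x) :=
    (measurePreserving_add_left volume a).setIntegral_image_emb
      (MeasurableEquiv.addLeft a).measurableEmbedding f (r • S)
  rw [h1, h2, h3]
  have : 0 < r ^ 2 := by positivity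
  simp [abs_of_pos this]
  field_simp

end AffineImage

section Refinement

theorem mem_refineTriangle {t s : Finset Plane} : s ∈ refineTriangle t ↔
    (s : Set Plane) = (fun x => (1 / 2 : ℝ) • (∑ y ∈ t, y) + (-(1 / 2) : ℝ) • x) '' t ∨
    ∃ v ∈ t, (s : Set Plane) = (fun x => (1 / 2 : ℝ) • v + (1 / 2 : ℝ) • x) '' t := by
  classical
  have h1 : ∀ x : Plane, (1 / 2 : ℝ) • ((∑ y ∈ t, y) - x)
      = (1 / 2 : ℝ) • (∑ y ∈ t, y) + (-(1 / 2) : ℝ) • x := fun x => by module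
  have h2 : ∀ v x : Plane, midpoint ℝ v x = (1 / 2 : ℝ) • v + (1 / 2 : ℝ) • x := fun v x => by
    rw [midpoint_eq_smul_add]; simp [smul_add]
  unfold refineTriangle
  rw [Finset.mem_insert, Finset.mem_image]
  simp only [← Finset.coe_inj, Finset.coe_image, h1, h2]
  constructor
  · rintro (h | ⟨v, hv, h⟩)
    · exact Or.inl h
    · exact Or.inr ⟨v, hv, h.symm⟩
  · rintro (h | ⟨v, hv, h⟩)
    · exact Or.inl h
    · exact Or.inr ⟨v, hv, h.symm⟩

/-- The factor is 1/2 for the corner triangles and -1/2 for the middle one, which is a reflected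
copy. -/
theorem exists_affine_of_mem_refineTriangle {t s : Finset Plane} (h : s ∈ refineTriangle t) :
    ∃ (a : Plane) (r : ℝ), |r| = 1 / 2 ∧ (s : Set Plane) = (fun x => a + r • x) '' t := by
  rcases mem_refineTriangle.1 h with h | ⟨v, -, h⟩
  · exact ⟨_, _, by norm_num, h⟩
  · exact ⟨_, _, by norm_num, h⟩

theorem card_refineTriangle_le {t : Finset Plane} (ht : t.card = 3) :
    (refineTriangle t).card ≤ 4 := by
  unfold refineTriangle
  refine (Finset.card_insert_le _ _).trans ?_
  have := Finset.card_image_le (s := t)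
    (f := fun v => @Finset.image _ _ (fun a b => Classical.propDecidable (a = b))
      (fun x => midpoint ℝ v x) t)
  rw [ht] at this
  exact Nat.succ_le_succ (by convert this)

/-- The refined triangles cover the triangle: a point with a barycentric coordinate at least `1/2`
lies in a corner triangle, the other points lie in the middle triangle. -/
theorem exists_mem_refineTriangle {t : Finset Plane} (ht : t.card = 3) {x : Plane}
    (hx : x ∈ convexHull ℝ (t : Set Plane)) :
    ∃ s ∈ refineTriangle t, x ∈ convexHull ℝ (s : Set Plane) := by
  classical
  obtain ⟨w, hw0, hw1, hwx⟩ := Finset.mem_convexHull'.1 hx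
  by_cases h : ∃ v ∈ t, 1 / 2 ≤ w v
  · obtain ⟨v, hv, hwv⟩ := h
    refine ⟨t.image (fun x => (1 / 2 : ℝ) • v + (1 / 2 : ℝ) • x),
      mem_refineTriangle.2 (Or.inr ⟨v, hv, by simp⟩), ?_⟩
    rw [Finset.coe_image, convexHull_image_add_smul]
    refine ⟨(2 : ℝ) • x - v, ?_, by module⟩
    -- Barycentric coordinates of the preimage 2x - v; the one at v is nonnegative because w v ≥
    -- 1/2.
    refine Finset.mem_convexHull'.2 ⟨fun y => 2 * w y - if y = v then 1 else 0, ?_, ?_, ?_⟩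
    · intro y hy
      by_cases hyv : y = v
      · subst hyv; simp; linarith
      · simp [hyv, hw0 y hy]
    · rw [Finset.sum_sub_distrib, ← Finset.mul_sum, hw1, Finset.sum_ite_eq' t v, if_pos hv]
      norm_num
    · simp only [sub_smul, Finset.sum_sub_distrib, mul_smul, ← Finset.smul_sum, hwx, ite_smul,
        one_smul, zero_smul, Finset.sum_ite_eq' t v, if_pos hv]
  · push Not at h
    refine ⟨t.image (fun x => (1 / 2 : ℝ) • (∑ y ∈ t, y) + (-(1 / 2) : ℝ) • x),
      mem_refineTriangle.2 (Or.inl (by simp)), ?_⟩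
    rw [Finset.coe_image, convexHull_image_add_smul]
    refine ⟨(∑ y ∈ t, y) - (2 : ℝ) • x, ?_, by module⟩
    -- These coordinates sum to 3 - 2 = 1, since there are three vertices.
    refine Finset.mem_convexHull'.2 ⟨fun y => 1 - 2 * w y, ?_, ?_, ?_⟩
    · intro y hy
      have := h y hy
      linarith
    · rw [Finset.sum_sub_distrib, ← Finset.mul_sum, hw1]
      simp [ht]
      norm_num
    · simp only [sub_smul, Finset.sum_sub_distrib, mul_smul, ← Finset.smul_sum, hwx, one_smul]

theorem volume_convexHull_lt_top (t : Finset Plane) :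
    volume (convexHull ℝ (t : Set Plane)) < ⊤ :=
  (t.finite_toSet.isCompact_convexHull ℝ).measure_lt_top

theorem measurableSet_convexHull (t : Finset Plane) :
    MeasurableSet (convexHull ℝ (t : Set Plane)) :=
  (t.finite_toSet.isCompact_convexHull ℝ).measurableSet

instance (t : Finset Plane) :
    IsFiniteMeasure (volume.restrict (convexHull ℝ (t : Set Plane))) :=
  ⟨by simpa using volume_convexHull_lt_top t⟩

theorem restrict_le_sum_restrict {M : Finset (Finset Plane)} {S : Set Plane}
    (h : ∀ x ∈ S, ∃ s ∈ M, x ∈ convexHull ℝ (s : Set Plane)) :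
    volume.restrict S ≤ ∑ s ∈ M, volume.restrict (convexHull ℝ (s : Set Plane)) := by
  refine Measure.le_iff.2 fun A hA => ?_
  rw [Measure.restrict_apply hA, Measure.finsetSum_apply]
  calc volume (A ∩ S) ≤ volume (⋃ s ∈ M, A ∩ convexHull ℝ (s : Set Plane)) := by
        refine measure_mono fun x hx => ?_
        obtain ⟨s, hs, hxs⟩ := h x hx.2
        exact Set.mem_biUnion hs ⟨hx.1, hxs⟩
    _ ≤ ∑ s ∈ M, volume (A ∩ convexHull ℝ (s : Set Plane)) := measure_biUnion_finset_le _ _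
    _ = _ := Finset.sum_congr rfl fun s _ => (Measure.restrict_apply hA).symm

/-- The refined triangles tile the triangle up to a null set. -/
theorem sum_restrict_refineTriangle {t : Finset Plane} (ht : t.card = 3) :
    ∑ s ∈ refineTriangle t, volume.restrict (convexHull ℝ (s : Set Plane))
      = volume.restrict (convexHull ℝ (t : Set Plane)) := by
  have hle := restrict_le_sum_restrict fun x hx => exists_mem_refineTriangle ht hx
  have hvol : ∀ s ∈ refineTriangle t, volume (convexHull ℝ (s : Set Plane))
      = ENNReal.ofReal (1 / 4) * volume (convexHull ℝ (t : Set Plane)) := fun s hs => by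
    obtain ⟨a, r, hr, hs⟩ := exists_affine_of_mem_refineTriangle hs
    rw [hs, convexHull_image_add_smul, volume_image_add_smul, ← sq_abs, hr]
    norm_num
  -- At most four triangles, each of a quarter of the area. Covering gives one inequality of
  -- measures, and equal finite total mass turns it into equality, so no overlaps have to be
  -- examined.
  have hmass : (∑ s ∈ refineTriangle t, volume.restrict (convexHull ℝ (s : Set Plane))) Set.univ
      ≤ volume (convexHull ℝ (t : Set Plane)) := by
    rw [Measure.finsetSum_apply]
    simp only [Measure.restrict_apply_univ]
    rw [Finset.sum_congr rfl hvol, Finset.sum_const, nsmul_eq_mul, ← mul_assoc]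
    refine (mul_le_mul' ?_ le_rfl).trans_eq (one_mul _)
    calc ((refineTriangle t).card : ENNReal) * ENNReal.ofReal (1 / 4)
        ≤ (4 : ℕ) * ENNReal.ofReal (1 / 4) := by
          gcongr
          exact card_refineTriangle_le ht
      _ = ENNReal.ofReal ((4 : ℕ) * (1 / 4)) := by
          rw [ENNReal.ofReal_mul (by positivity), ENNReal.ofReal_natCast]
      _ = 1 := by norm_num
  refine (Measure.eq_of_le_of_measure_univ_eq hle (le_antisymm (hle _) ?_)).symm
  simpa using hmass

end Refinement

/-! ### The triangles of level k: similarity, covering, multiplicity, grid size -/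

namespace Triangulation

variable {Ω : Set Plane} (T : Triangulation Ω)

theorem mem_level_succ {k : ℕ} {s : Finset Plane} :
    s ∈ T.level (k + 1) ↔ ∃ t ∈ T.level k, s ∈ refineTriangle t := by
  simp [level]

theorem exists_affine_of_mem_level {k : ℕ} {s : Finset Plane} (hs : s ∈ T.level k) :
    ∃ t ∈ T.triangles, ∃ (a : Plane) (r : ℝ), |r| = (1 / 2) ^ k ∧
      (s : Set Plane) = (fun x => a + r • x) '' t := by
  induction k generalizing s with
  | zero => exact ⟨s, hs, 0, 1, by simp, by simp⟩
  | succ k ih =>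
    obtain ⟨s', hs', h⟩ := T.mem_level_succ.1 hs
    obtain ⟨t, ht, a, r, hr, e⟩ := ih hs'
    obtain ⟨b, q, hq, e'⟩ := exists_affine_of_mem_refineTriangle h
    refine ⟨t, ht, b + q • a, q * r, by rw [abs_mul, hq, hr, pow_succ'], ?_⟩
    rw [e', e, Set.image_image]
    simp only [smul_add, mul_smul, add_assoc]

theorem card_of_mem_level {k : ℕ} {s : Finset Plane} (hs : s ∈ T.level k) : s.card = 3 := by
  obtain ⟨t, ht, a, r, hr, e⟩ := T.exists_affine_of_mem_level hs
  have hr0 : r ≠ 0 := by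
    rintro rfl
    have : (0 : ℝ) < (1 / 2) ^ k := by positivity
    rw [← hr, abs_zero] at this
    exact lt_irrefl _ this
  have hinj : Function.Injective fun x : Plane => a + r • x := fun x y h => by
    simpa [hr0] using h
  rw [← Set.ncard_coe_finset, e, Set.ncard_image_of_injective _ hinj, Set.ncard_coe_finset,
    T.card_eq t ht]

theorem exists_mem_level {x : Plane} (hx : x ∈ closure Ω) (k : ℕ) :
    ∃ s ∈ T.level k, x ∈ convexHull ℝ (s : Set Plane) := by
  induction k with
  | zero =>
    rw [← T.cover] at hx
    simpa [level] using hx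
  | succ k ih =>
    obtain ⟨t, ht, hxt⟩ := ih
    obtain ⟨s, hs, hxs⟩ := exists_mem_refineTriangle (T.card_of_mem_level ht) hxt
    exact ⟨s, T.mem_level_succ.2 ⟨t, ht, hs⟩, hxs⟩

/-- Bounds the overlap of the cells uniformly in k: refinement preserves the sum over the children
of one triangle, and collecting all children in one finite set can only identify coinciding ones. -/
theorem sum_restrict_level_le (k : ℕ) :
    ∑ s ∈ T.level k, volume.restrict (convexHull ℝ (s : Set Plane))
      ≤ ∑ s ∈ T.triangles, volume.restrict (convexHull ℝ (s : Set Plane)) := by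
  classical
  induction k with
  | zero => exact le_rfl
  | succ k ih =>
    refine le_trans ?_ ih
    refine le_trans ?_ (Finset.sum_congr rfl fun t ht =>
      sum_restrict_refineTriangle (T.card_of_mem_level ht)).le
    have : T.level (k + 1) = (T.level k).biUnion refineTriangle := by
      ext s
      simp [mem_level_succ]
    rw [this]
    refine Measure.le_iff.2 fun A hA => ?_
    simp only [Measure.finsetSum_apply]
    exact Finset.sum_biUnion_le_sum (T.level k) refineTriangle
      fun s => volume.restrict (convexHull ℝ (s : Set Plane)) A

/-- A crude count of multiplicity, enough for a constant that depends only on the initial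
triangulation. -/
theorem sum_restrict_triangles_le :
    ∑ s ∈ T.triangles, volume.restrict (convexHull ℝ (s : Set Plane))
      ≤ T.triangles.card • volume.restrict (closure Ω) := by
  rw [← Finset.sum_const]
  refine Finset.sum_le_sum fun s hs => Measure.restrict_mono ?_ le_rfl
  rw [← T.cover]
  exact Set.subset_biUnion_of_mem (u := fun t : Finset Plane => convexHull ℝ (t : Set Plane)) hs

/-- Similarities of ratio 2⁻ᵏ scale all edges. The bound later converts 2ᵏ into at most h_0 / h_k.
-/
theorem gridSize_le (k : ℕ) : T.gridSize k ≤ (1 / 2) ^ k * T.gridSize 0 := by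
  unfold gridSize
  have : ((1 / 2 : ℝ) ^ k) = (((1 / 2) ^ k : ℝ≥0) : ℝ) := by simp
  rw [this, ← NNReal.coe_mul, NNReal.coe_le_coe]
  refine Finset.sup_le fun s hs => Finset.sup_le fun e he => ?_
  obtain ⟨t, ht, a, r, hr, hst⟩ := T.exists_affine_of_mem_level hs
  rw [Finset.mem_product] at he
  obtain ⟨he1, he2⟩ := he
  rw [← Finset.mem_coe, hst] at he1 he2
  obtain ⟨x, hx, hx'⟩ := he1
  obtain ⟨y, hy, hy'⟩ := he2
  have h1 : nndist e.1 e.2 = (1 / 2) ^ k * nndist x y := by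
    rw [← NNReal.coe_inj, NNReal.coe_mul, ← this, ← hr, coe_nndist, coe_nndist, ← hx', ← hy']
    simp [dist_smul₀]
  rw [h1]
  gcongr
  exact (Finset.le_sup (f := fun e : Plane × Plane => nndist e.1 e.2)
    (Finset.mk_mem_product hx hy)).trans
    (Finset.le_sup (f := fun t : Finset Plane => (t ×ˢ t).sup fun e => nndist e.1 e.2) ht)

theorem gridSize_pos (hΩ : Ω.Nonempty) (k : ℕ) : 0 < T.gridSize k := by
  obtain ⟨x, hx⟩ := hΩ
  obtain ⟨s, hs, -⟩ := T.exists_mem_level (subset_closure hx) k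
  obtain ⟨a, ha, b, hb, hab⟩ := Finset.one_lt_card.1
    ((by norm_num : 1 < 3).trans_eq (T.card_of_mem_level hs).symm)
  have hpos : 0 < nndist a b := dist_pos.2 hab
  refine NNReal.coe_pos.2 (hpos.trans_le ?_)
  exact (Finset.le_sup (f := fun e : Plane × Plane => nndist e.1 e.2)
    (Finset.mk_mem_product ha hb)).trans
    (Finset.le_sup (f := fun t : Finset Plane => (t ×ˢ t).sup fun e => nndist e.1 e.2) hs)

end Triangulation

end Stokes

/-! ### The inverse inequality for quadratic polynomials -/

/-- F factors through the range of G, and a linear map on that finite-dimensional space is bounded.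
-/
theorem LinearMap.exists_norm_le_mul_norm_of_ker_le {V W₁ W₂ : Type*} [AddCommGroup V] [Module ℝ V]
    [FiniteDimensional ℝ V] [NormedAddCommGroup W₁] [NormedSpace ℝ W₁] [NormedAddCommGroup W₂]
    [NormedSpace ℝ W₂] (F : V →ₗ[ℝ] W₁) (G : V →ₗ[ℝ] W₂) (h : LinearMap.ker G ≤ LinearMap.ker F) :
    ∃ C : ℝ, 0 ≤ C ∧ ∀ v, ‖F v‖ ≤ C * ‖G v‖ := by
  let H : LinearMap.range G →L[ℝ] W₁ := LinearMap.toContinuousLinearMap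
    (((LinearMap.ker G).liftQ F h).comp G.quotKerEquivRange.symm.toLinearMap)
  refine ⟨‖H‖, H.opNorm_nonneg, fun v => ?_⟩
  have : F v = H ⟨G v, LinearMap.mem_range_self G v⟩ := by
    have e : G.quotKerEquivRange.symm ⟨G v, LinearMap.mem_range_self G v⟩
        = (LinearMap.ker G).mkQ v := G.quotKerEquivRange_symm_apply_image v _
    simp [H, e]
  rw [this]
  exact H.le_opNorm _

namespace Stokes

/-- The quadratic polynomial in two variables with given coefficients. -/
def quad : (Fin 6 → ℝ) →ₗ[ℝ] (Plane → ℝ) where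
  toFun c x := c 0 + c 1 * x 0 + c 2 * x 1 + c 3 * (x 0 * x 0) + c 4 * (x 0 * x 1)
    + c 5 * (x 1 * x 1)
  map_add' c d := by ext x; simp; ring
  map_smul' r c := by ext x; simp; ring

/-- The coefficients of the partial derivatives of a quadratic polynomial. -/
def quadDeriv (j : Fin 2) : (Fin 6 → ℝ) →ₗ[ℝ] (Fin 6 → ℝ) where
  toFun c := if j = 0 then ![c 1, 2 * c 3, c 4, 0, 0, 0] else ![c 2, c 4, 2 * c 5, 0, 0, 0]
  map_add' c d := by split_ifs <;> ext i <;> fin_cases i <;> simp <;> ring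
  map_smul' r c := by split_ifs <;> ext i <;> fin_cases i <;> simp <;> ring

theorem quad_apply (c : Fin 6 → ℝ) (x : Plane) :
    quad c x = c 0 + c 1 * x 0 + c 2 * x 1 + c 3 * (x 0 * x 0) + c 4 * (x 0 * x 1)
      + c 5 * (x 1 * x 1) := rfl

theorem quad_quadDeriv_zero (c : Fin 6 → ℝ) (x : Plane) :
    quad (quadDeriv 0 c) x = c 1 + 2 * c 3 * x 0 + c 4 * x 1 := by
  simp [quad_apply, quadDeriv]

theorem quad_quadDeriv_one (c : Fin 6 → ℝ) (x : Plane) :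
    quad (quadDeriv 1 c) x = c 2 + c 4 * x 0 + 2 * c 5 * x 1 := by
  simp [quad_apply, quadDeriv]

theorem hasFDerivAt_quad (c : Fin 6 → ℝ) (x : Plane) :
    HasFDerivAt (quad c) (quad (quadDeriv 0 c) x • (EuclideanSpace.proj 0 : Plane →L[ℝ] ℝ)
      + quad (quadDeriv 1 c) x • (EuclideanSpace.proj 1 : Plane →L[ℝ] ℝ)) x := by
  have h0 : HasFDerivAt (fun x : Plane => x 0) (EuclideanSpace.proj 0 : Plane →L[ℝ] ℝ) x :=
    (EuclideanSpace.proj 0 : Plane →L[ℝ] ℝ).hasFDerivAt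
  have h1 : HasFDerivAt (fun x : Plane => x 1) (EuclideanSpace.proj 1 : Plane →L[ℝ] ℝ) x :=
    (EuclideanSpace.proj 1 : Plane →L[ℝ] ℝ).hasFDerivAt
  have h := (((((hasFDerivAt_const (c 0) x).add (h0.const_mul (c 1))).add
    (h1.const_mul (c 2))).add ((h0.mul h0).const_mul (c 3))).add
    ((h0.mul h1).const_mul (c 4))).add ((h1.mul h1).const_mul (c 5))
  refine HasFDerivAt.congr_fderiv (f := quad c) h ?_
  ext v
  simp [quad_quadDeriv_zero, quad_quadDeriv_one]
  ring

theorem continuous_quad (c : Fin 6 → ℝ) : Continuous (quad c) :=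
  continuous_iff_continuousAt.2 fun x => (hasFDerivAt_quad c x).continuousAt

theorem fderiv_quad (c : Fin 6 → ℝ) (x : Plane) (j : Fin 2) :
    fderiv ℝ (quad c) x (EuclideanSpace.single j 1) = quad (quadDeriv j c) x := by
  rw [(hasFDerivAt_quad c x).fderiv]
  fin_cases j <;> simp

theorem exists_quad_eq_eval {q : MvPolynomial (Fin 2) ℝ} (hq : q.totalDegree ≤ 2) :
    ∃ c, ∀ x : Plane, MvPolynomial.eval (fun j => x j) q = quad c x := by
  have : (fun x : Plane => MvPolynomial.eval (fun j => x j) q) ∈ LinearMap.range quad := by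
    have e : (fun x : Plane => MvPolynomial.eval (fun j => x j) q)
        = ∑ d ∈ q.support, q.coeff d • fun x : Plane => x 0 ^ d 0 * x 1 ^ d 1 := by
      ext x
      rw [MvPolynomial.eval_eq']
      simp
    rw [e]
    refine Submodule.sum_mem _ fun d hd => Submodule.smul_mem _ _ ?_
    have hdeg : d 0 + d 1 ≤ 2 := by
      have := (MvPolynomial.le_totalDegree hd).trans hq
      rw [Finsupp.sum_fintype _ _ (by simp)] at this
      simpa using this
    generalize d 0 = a at hdeg
    generalize d 1 = b at hdeg
    have ha : a ≤ 2 := by omega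
    interval_cases a
    · have hb : b ≤ 2 := by omega
      interval_cases b
      · exact ⟨Pi.single 0 1, by ext x; simp [quad_apply]⟩
      · exact ⟨Pi.single 2 1, by ext x; simp [quad_apply]⟩
      · exact ⟨Pi.single 5 1, by ext x; simp [quad_apply, sq]⟩
    · have hb : b ≤ 1 := by omega
      interval_cases b
      · exact ⟨Pi.single 1 1, by ext x; simp [quad_apply]⟩
      · exact ⟨Pi.single 4 1, by ext x; simp [quad_apply]⟩
    · obtain rfl : b = 0 := by omega
      exact ⟨Pi.single 3 1, by ext x; simp [quad_apply, sq]⟩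
  obtain ⟨c, hc⟩ := this
  exact ⟨c, fun x => (congrFun hc x).symm⟩

theorem exists_quad_comp_add_smul (c : Fin 6 → ℝ) (a : Plane) (r : ℝ) :
    ∃ d, (∀ x, quad d x = quad c (a + r • x)) ∧
      ∀ j x, quad (quadDeriv j d) x = r * quad (quadDeriv j c) (a + r • x) := by
  -- Taylor coefficients at a, scaled by powers of r.
  refine ⟨![quad c a, r * quad (quadDeriv 0 c) a, r * quad (quadDeriv 1 c) a,
    r ^ 2 * c 3, r ^ 2 * c 4, r ^ 2 * c 5], fun x => ?_, fun j x => ?_⟩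
  · rw [quad_quadDeriv_zero, quad_quadDeriv_one]
    simp [quad_apply]
    ring
  · fin_cases j
    · simp only [Fin.zero_eta, quad_quadDeriv_zero]
      simp
      ring
    · simp only [Fin.mk_one, quad_quadDeriv_one]
      simp
      ring

theorem norm_sq_toLp_two {α : Type*} [MeasurableSpace α] {μ : Measure α} {f : α → ℝ}
    (hf : MemLp f 2 μ) : ‖hf.toLp f‖ ^ 2 = ∫ x, f x ^ 2 ∂μ := by
  rw [← real_inner_self_eq_norm_sq, L2.inner_def]
  refine integral_congr_ae ?_
  filter_upwards [hf.coeFn_toLp] with x hx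
  simp [hx, sq]

/-- The inverse inequality for quadratic polynomials on a fixed convex compact set. -/
theorem exists_inverse_inequality_quad {K : Set Plane} (hK : IsCompact K) (hKc : Convex ℝ K) :
    ∃ C : ℝ, 0 ≤ C ∧ ∀ j c,
      ∫ x in K, quad (quadDeriv j c) x ^ 2 ≤ C * ∫ x in K, quad c x ^ 2 := by
  have : IsFiniteMeasure (volume.restrict K) := ⟨by simpa using hK.measure_lt_top⟩
  have hmem : ∀ c, MemLp (quad c) 2 (volume.restrict K) := fun c => by
    obtain ⟨b, hb⟩ := hK.exists_bound_of_continuousOn (continuous_quad c).continuousOn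
    exact MemLp.of_bound (continuous_quad c).aestronglyMeasurable b
      ((ae_restrict_iff' hK.measurableSet).2 (.of_forall hb))
  let G : (Fin 6 → ℝ) →ₗ[ℝ] Lp ℝ 2 (volume.restrict K) :=
    { toFun := fun c => (hmem c).toLp (quad c)
      map_add' := fun c d => by
        rw [← MemLp.toLp_add]
        exact MemLp.toLp_congr _ _ (.of_forall fun x => by simp)
      map_smul' := fun r c => by
        rw [RingHom.id_apply, ← MemLp.toLp_const_smul]
        exact MemLp.toLp_congr _ _ (.of_forall fun x => by simp) }
  have hG : ∀ c, ‖G c‖ ^ 2 = ∫ x in K, quad c x ^ 2 := fun c => norm_sq_toLp_two (hmem c)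
  have hG0 : ∀ c, G c = 0 ↔ quad c =ᵐ[volume.restrict K] 0 := fun c => by
    change (hmem c).toLp _ = 0 ↔ _
    rw [← MemLp.toLp_zero MemLp.zero', MemLp.toLp_eq_toLp_iff]
  -- A quadratic vanishing a.e. on K vanishes on the interior, hence so do its derivatives; the
  -- frontier of a convex set is null. An empty interior does no harm.
  have hker : ∀ j, LinearMap.ker G ≤ LinearMap.ker (G ∘ₗ quadDeriv j) := fun j c hc => by
    rw [LinearMap.mem_ker, hG0] at hc
    rw [LinearMap.mem_ker, LinearMap.comp_apply, hG0]
    have h0 : Set.EqOn (quad c) 0 (interior K) :=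
      Measure.eqOn_open_of_ae_eq (ae_restrict_of_ae_restrict_of_subset interior_subset hc)
        isOpen_interior (continuous_quad c).continuousOn continuousOn_const
    have h1 : ∀ x ∈ interior K, quad (quadDeriv j c) x = 0 := fun x hx => by
      have : quad c =ᶠ[nhds x] fun _ => (0 : ℝ) :=
        Filter.eventuallyEq_of_mem (isOpen_interior.mem_nhds hx) h0
      rw [← fderiv_quad, this.fderiv_eq]
      simp
    have h2 : ∀ᵐ x : Plane, x ∉ frontier K := by
      simpa [ae_iff] using hKc.addHaar_frontier volume
    filter_upwards [ae_restrict_of_ae h2, ae_restrict_mem hK.measurableSet] with x hx hxK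
    refine h1 x ?_
    by_contra hxi
    exact hx ⟨subset_closure hxK, hxi⟩
  choose C hC0 hC using fun j =>
    LinearMap.exists_norm_le_mul_norm_of_ker_le (G ∘ₗ quadDeriv j) G (hker j)
  refine ⟨C 0 ^ 2 + C 1 ^ 2, by positivity, fun j c => ?_⟩
  have h1 : ∫ x in K, quad (quadDeriv j c) x ^ 2 ≤ C j ^ 2 * ∫ x in K, quad c x ^ 2 := by
    rw [← hG, ← hG, ← mul_pow]
    exact pow_le_pow_left₀ (norm_nonneg _) (hC j c) 2
  refine h1.trans (mul_le_mul_of_nonneg_right ?_ (integral_nonneg fun x => sq_nonneg _))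
  fin_cases j <;> simp [sq_nonneg]

/-- The scaled inverse inequality on a similar image of a convex compact set. -/
theorem setIntegral_quadDeriv_image_le {K : Set Plane} {C : ℝ}
    (hC : ∀ j c, ∫ x in K, quad (quadDeriv j c) x ^ 2 ≤ C * ∫ x in K, quad c x ^ 2)
    (a : Plane) {r : ℝ} (hr : r ≠ 0) (j : Fin 2) (c : Fin 6 → ℝ) :
    ∫ x in (fun x => a + r • x) '' K, quad (quadDeriv j c) x ^ 2
      ≤ C * (r ^ 2)⁻¹ * ∫ x in (fun x => a + r • x) '' K, quad c x ^ 2 := by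
  obtain ⟨d, hd, hd'⟩ := exists_quad_comp_add_smul c a r
  rw [setIntegral_image_add_smul a hr, setIntegral_image_add_smul a hr, ← integral_const_mul]
  have h := hC j d
  simp only [hd, hd', mul_pow] at h
  refine h.trans_eq ?_
  field_simp

/-! ### Derivatives and integrability of finite element functions -/

namespace Triangulation

variable {Ω : Set Plane} (T : Triangulation Ω) {k : ℕ}

/-- Cell frontiers are null. At the remaining points a velocity is locally one polynomial, so
`fderiv` is its true derivative and not the default value 0. -/
theorem ae_mem_interior (k : ℕ) : ∀ᵐ x : Plane, x ∈ closure Ω →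
    ∃ s ∈ T.level k, x ∈ interior (convexHull ℝ (s : Set Plane)) := by
  have h : ∀ᵐ x : Plane, ∀ s ∈ T.level k, x ∉ frontier (convexHull ℝ (s : Set Plane)) := by
    refine (ae_ball_iff (T.level k).countable_toSet).2 fun s _ => ?_
    simpa [ae_iff] using (convex_convexHull ℝ (s : Set Plane)).addHaar_frontier volume
  filter_upwards [h] with x hx hxΩ
  obtain ⟨s, hs, hxs⟩ := T.exists_mem_level hxΩ k
  refine ⟨s, hs, ?_⟩
  by_contra hxi
  exact hx s hs ⟨subset_closure hxs, hxi⟩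

theorem ae_mem_interior_convexHull (s : Finset Plane) :
    ∀ᵐ x ∂volume.restrict (convexHull ℝ (s : Set Plane)),
      x ∈ interior (convexHull ℝ (s : Set Plane)) := by
  have h2 : ∀ᵐ x : Plane, x ∉ frontier (convexHull ℝ (s : Set Plane)) := by
    simpa [ae_iff] using (convex_convexHull ℝ (s : Set Plane)).addHaar_frontier volume
  filter_upwards [ae_restrict_of_ae h2, ae_restrict_mem (measurableSet_convexHull s)] with x hx hxK
  by_contra hxi
  exact hx ⟨subset_closure hxK, hxi⟩

theorem exists_quad_of_mem_velocity {u : Plane → Plane} (hu : u ∈ T.velocity k)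
    {s : Finset Plane} (hs : s ∈ T.level k) (i : Fin 2) :
    ∃ c, ∀ x ∈ convexHull ℝ (s : Set Plane), u x i = quad c x := by
  obtain ⟨q, hq, hq'⟩ := (hu.1 i).2.2 s hs
  obtain ⟨c, hc⟩ := exists_quad_eq_eval hq
  exact ⟨c, fun x hx => (hq' x hx).trans (hc x)⟩

theorem differentiableAt_of_mem_velocity {u : Plane → Plane} (hu : u ∈ T.velocity k)
    {s : Finset Plane} (hs : s ∈ T.level k) {x : Plane}
    (hx : x ∈ interior (convexHull ℝ (s : Set Plane))) : DifferentiableAt ℝ u x := by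
  rw [differentiableAt_euclidean]
  intro i
  obtain ⟨c, hc⟩ := T.exists_quad_of_mem_velocity hu hs i
  exact (hasFDerivAt_quad c x).differentiableAt.congr_of_eventuallyEq
    (Filter.eventuallyEq_of_mem (mem_interior_iff_mem_nhds.1 hx) hc)

theorem partialDeriv_eq_quad {u : Plane → Plane} (hu : u ∈ T.velocity k)
    {s : Finset Plane} (hs : s ∈ T.level k) {i : Fin 2} {c : Fin 6 → ℝ}
    (hc : ∀ x ∈ convexHull ℝ (s : Set Plane), u x i = quad c x) {x : Plane}
    (hx : x ∈ interior (convexHull ℝ (s : Set Plane))) (j : Fin 2) :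
    partialDeriv u i j x = quad (quadDeriv j c) x := by
  have hd := T.differentiableAt_of_mem_velocity hu hs hx
  have h1 := ((EuclideanSpace.proj i : Plane →L[ℝ] ℝ).hasFDerivAt.comp x hd.hasFDerivAt).fderiv
  have h2 : (⇑(EuclideanSpace.proj i : Plane →L[ℝ] ℝ) ∘ u) =ᶠ[nhds x] quad c :=
    Filter.eventuallyEq_of_mem (mem_interior_iff_mem_nhds.1 hx) hc
  rw [h2.fderiv_eq] at h1
  rw [← fderiv_quad, h1]
  rfl

theorem ae_differentiableAt {u : Plane → Plane} (hu : u ∈ T.velocity k) :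
    ∀ᵐ x ∂volume.restrict Ω, DifferentiableAt ℝ u x := by
  refine ae_restrict_of_ae_restrict_of_subset subset_closure
    ((ae_restrict_iff' isClosed_closure.measurableSet).2 ?_)
  filter_upwards [T.ae_mem_interior k] with x hx hxΩ
  obtain ⟨s, hs, hxs⟩ := hx hxΩ
  exact T.differentiableAt_of_mem_velocity hu hs hxs

end Triangulation

theorem measurable_partialDeriv (u : Plane → Plane) (i j : Fin 2) :
    Measurable (partialDeriv u i j) :=
  (EuclideanSpace.proj i : Plane →L[ℝ] ℝ).measurable.comp
    (measurable_fderiv_apply_const ℝ u (EuclideanSpace.single j (1 : ℝ)))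

namespace Triangulation

variable {Ω : Set Plane} (T : Triangulation Ω) {k : ℕ}

theorem exists_bound_partialDeriv {u : Plane → Plane} (hu : u ∈ T.velocity k) (i j : Fin 2) :
    ∃ b : ℝ, ∀ᵐ x ∂volume.restrict Ω, ‖partialDeriv u i j x‖ ≤ b := by
  have h : ∀ s : Finset Plane, ∃ b : ℝ, 0 ≤ b ∧ (s ∈ T.level k →
      ∀ x ∈ interior (convexHull ℝ (s : Set Plane)), ‖partialDeriv u i j x‖ ≤ b) := fun s => by
    by_cases hs : s ∈ T.level k
    · obtain ⟨c, hc⟩ := T.exists_quad_of_mem_velocity hu hs i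
      obtain ⟨b, hb⟩ := (s.finite_toSet.isCompact_convexHull ℝ).exists_bound_of_continuousOn
        (continuous_quad (quadDeriv j c)).continuousOn
      refine ⟨max b 0, le_max_right _ _, fun _ x hx => ?_⟩
      rw [T.partialDeriv_eq_quad hu hs hc hx]
      exact (hb x (interior_subset hx)).trans (le_max_left _ _)
    · exact ⟨0, le_rfl, fun h => absurd h hs⟩
  choose b hb0 hb using h
  refine ⟨∑ s ∈ T.level k, b s, ae_restrict_of_ae_restrict_of_subset subset_closure
    ((ae_restrict_iff' isClosed_closure.measurableSet).2 ?_)⟩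
  filter_upwards [T.ae_mem_interior k] with x hx hxΩ
  obtain ⟨s, hs, hxs⟩ := hx hxΩ
  exact (hb s hs x hxs).trans (Finset.single_le_sum (fun s _ => hb0 s) hs)

theorem memLp_partialDeriv (hΩ : Bornology.IsBounded Ω) {u : Plane → Plane}
    (hu : u ∈ T.velocity k) (i j : Fin 2) :
    MemLp (partialDeriv u i j) 2 (volume.restrict Ω) := by
  have : IsFiniteMeasure (volume.restrict Ω) := ⟨by simpa using hΩ.measure_lt_top⟩
  obtain ⟨b, hb⟩ := T.exists_bound_partialDeriv hu i j
  exact MemLp.of_bound (measurable_partialDeriv u i j).aestronglyMeasurable b hb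

end Triangulation

section LagrangeSpace

variable {Ω : Set Plane} {M : Finset (Finset Plane)} {r : ℕ}

theorem memLp_closure_of_mem_lagrangeSpace (hΩ : Bornology.IsBounded Ω) {v : Plane → ℝ}
    (hv : v ∈ lagrangeSpace Ω M r) : MemLp v 2 (volume.restrict (closure Ω)) := by
  have : IsFiniteMeasure (volume.restrict (closure Ω)) :=
    ⟨by simpa using hΩ.closure.measure_lt_top⟩
  obtain ⟨b, hb⟩ := hΩ.isCompact_closure.exists_bound_of_continuousOn hv.1
  exact MemLp.of_bound (hv.1.aestronglyMeasurable isClosed_closure.measurableSet) b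
    ((ae_restrict_iff' isClosed_closure.measurableSet).2 (.of_forall hb))

theorem memLp_of_mem_lagrangeSpace (hΩ : Bornology.IsBounded Ω) {v : Plane → ℝ}
    (hv : v ∈ lagrangeSpace Ω M r) : MemLp v 2 (volume.restrict Ω) :=
  (memLp_closure_of_mem_lagrangeSpace hΩ hv).mono_measure
    (Measure.restrict_mono subset_closure le_rfl)

/-- Continuity carries the zero to Ω and then to its closure; outside, functions are zero by
convention. This makes the mass matrices definite. -/
theorem eq_zero_of_mem_lagrangeSpace (hΩ : IsOpen Ω) {v : Plane → ℝ}
    (hv : v ∈ lagrangeSpace Ω M r) (h : v =ᵐ[volume.restrict Ω] 0) : v = 0 := by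
  have h1 : Set.EqOn v 0 Ω :=
    Measure.eqOn_open_of_ae_eq h hΩ (hv.1.mono subset_closure) continuousOn_const
  have h2 : Set.EqOn v 0 (closure Ω) :=
    h1.of_subset_closure hv.1 continuousOn_const subset_closure le_rfl
  ext x
  by_cases hx : x ∈ closure Ω
  · exact h2 hx
  · exact hv.2.1 x hx

end LagrangeSpace

namespace Triangulation

variable {Ω : Set Plane} (T : Triangulation Ω)

/-- `u ↦ ∂_j u_i`, from the velocity space to `L²(Ω)`. -/
def partialL2 (hΩ : Bornology.IsBounded Ω) (k : ℕ) (i j : Fin 2) :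
    T.velocity k →ₗ[ℝ] Lp ℝ 2 (volume.restrict Ω) where
  toFun u := (T.memLp_partialDeriv hΩ u.2 i j).toLp _
  map_add' u w := by
    rw [← MemLp.toLp_add]
    refine MemLp.toLp_congr _ _ ?_
    -- Additivity of `fderiv` needs differentiability of both fields, so it holds only almost
    -- everywhere; this suffices in L².
    filter_upwards [T.ae_differentiableAt u.2, T.ae_differentiableAt w.2] with x hu hw
    simp [partialDeriv, fderiv_add hu hw]
  map_smul' r u := by
    rw [RingHom.id_apply, ← MemLp.toLp_const_smul]
    refine MemLp.toLp_congr _ _ ?_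
    filter_upwards [T.ae_differentiableAt u.2] with x hu
    simp [partialDeriv, fderiv_const_smul hu]

/-- `u ↦ u_i`, from the velocity space to `L²(Ω)`. -/
def componentL2 (hΩ : Bornology.IsBounded Ω) (k : ℕ) (i : Fin 2) :
    T.velocity k →ₗ[ℝ] Lp ℝ 2 (volume.restrict Ω) where
  toFun u := (memLp_of_mem_lagrangeSpace hΩ (u.2.1 i)).toLp _
  map_add' u w := by
    rw [← MemLp.toLp_add]
    exact MemLp.toLp_congr _ _ (.of_forall fun x => by simp)
  map_smul' r u := by
    rw [RingHom.id_apply, ← MemLp.toLp_const_smul]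
    exact MemLp.toLp_congr _ _ (.of_forall fun x => by simp)

/-- The embedding of the pressure space in `L²(Ω)`. -/
def pressureL2 (hΩ : Bornology.IsBounded Ω) (k : ℕ) :
    T.pressure k →ₗ[ℝ] Lp ℝ 2 (volume.restrict Ω) where
  toFun p := (memLp_of_mem_lagrangeSpace hΩ p.2.1).toLp _
  map_add' u w := by
    rw [← MemLp.toLp_add]
    exact MemLp.toLp_congr _ _ (.of_forall fun x => by simp)
  map_smul' r u := by
    rw [RingHom.id_apply, ← MemLp.toLp_const_smul]
    exact MemLp.toLp_congr _ _ (.of_forall fun x => by simp)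

end Triangulation

theorem inner_toLp_toLp {α : Type*} [MeasurableSpace α] {μ : Measure α} {f g : α → ℝ}
    (hf : MemLp f 2 μ) (hg : MemLp g 2 μ) :
    inner ℝ (hf.toLp f) (hg.toLp g) = ∫ x, f x * g x ∂μ := by
  rw [L2.inner_def]
  refine integral_congr_ae ?_
  filter_upwards [hf.coeFn_toLp, hg.coeFn_toLp] with x hx hy
  simp [hx, hy, mul_comm]

/-! ### The forms as L² inner products, and the inverse inequality on all levels -/

namespace Triangulation

variable {Ω : Set Plane} (T : Triangulation Ω) {k : ℕ} (hΩ : Bornology.IsBounded Ω)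

theorem gradInner_eq (u w : T.velocity k) : gradInner Ω u w
    = ∑ i, ∑ j, inner ℝ (T.partialL2 hΩ k i j u) (T.partialL2 hΩ k i j w) := by
  have hI : ∀ i j, Integrable (fun x => partialDeriv u i j x * partialDeriv w i j x)
      (volume.restrict Ω) := fun i j =>
    (T.memLp_partialDeriv hΩ u.2 i j).integrable_mul (T.memLp_partialDeriv hΩ w.2 i j)
  unfold gradInner
  rw [integral_finsetSum _ fun i _ => integrable_finsetSum _ fun j _ => hI i j]
  refine Finset.sum_congr rfl fun i _ => ?_
  rw [integral_finsetSum _ fun j _ => hI i j]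
  exact Finset.sum_congr rfl fun j _ =>
    (inner_toLp_toLp (T.memLp_partialDeriv hΩ u.2 i j) (T.memLp_partialDeriv hΩ w.2 i j)).symm

theorem vecInner_eq (u w : T.velocity k) : vecInner Ω u w
    = ∑ i, inner ℝ (T.componentL2 hΩ k i u) (T.componentL2 hΩ k i w) := by
  have hI : ∀ i, Integrable (fun x => (u : Plane → Plane) x i * (w : Plane → Plane) x i)
      (volume.restrict Ω) := fun i =>
    (memLp_of_mem_lagrangeSpace hΩ (u.2.1 i)).integrable_mul
      (memLp_of_mem_lagrangeSpace hΩ (w.2.1 i))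
  unfold vecInner
  rw [integral_finsetSum _ fun i _ => hI i]
  exact Finset.sum_congr rfl fun i _ => (inner_toLp_toLp
    (memLp_of_mem_lagrangeSpace hΩ (u.2.1 i)) (memLp_of_mem_lagrangeSpace hΩ (w.2.1 i))).symm

theorem scalInner_eq (p q : T.pressure k) : scalInner Ω p q
    = inner ℝ (T.pressureL2 hΩ k p) (T.pressureL2 hΩ k q) :=
  (inner_toLp_toLp (memLp_of_mem_lagrangeSpace hΩ p.2.1)
    (memLp_of_mem_lagrangeSpace hΩ q.2.1)).symm

theorem bForm_eq (u : T.velocity k) (p : T.pressure k) : bForm Ω u p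
    = ∑ i, inner ℝ (T.partialL2 hΩ k i i u) (T.pressureL2 hΩ k p) := by
  have hI : ∀ i, Integrable (fun x => partialDeriv u i i x * (p : Plane → ℝ) x)
      (volume.restrict Ω) := fun i =>
    (T.memLp_partialDeriv hΩ u.2 i i).integrable_mul (memLp_of_mem_lagrangeSpace hΩ p.2.1)
  unfold bForm scalInner divergence
  simp only [Finset.sum_mul]
  rw [integral_finsetSum _ fun i _ => hI i]
  exact Finset.sum_congr rfl fun i _ => (inner_toLp_toLp
    (T.memLp_partialDeriv hΩ u.2 i i) (memLp_of_mem_lagrangeSpace hΩ p.2.1)).symm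

theorem eq_zero_of_componentL2 (ho : IsOpen Ω) {u : T.velocity k}
    (h : ∀ i, T.componentL2 hΩ k i u = 0) : u = 0 := by
  have : ∀ i, (fun x => (u : Plane → Plane) x i) = 0 := fun i => by
    refine eq_zero_of_mem_lagrangeSpace ho (u.2.1 i) ?_
    have := h i
    change (memLp_of_mem_lagrangeSpace hΩ (u.2.1 i)).toLp _ = 0 at this
    rw [← MemLp.toLp_zero MemLp.zero', MemLp.toLp_eq_toLp_iff] at this
    exact this
  ext x i
  exact congrFun (this i) x

theorem eq_zero_of_pressureL2 (ho : IsOpen Ω) {p : T.pressure k}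
    (h : T.pressureL2 hΩ k p = 0) : p = 0 := by
  have : (p : Plane → ℝ) = 0 := by
    refine eq_zero_of_mem_lagrangeSpace ho p.2.1 ?_
    change (memLp_of_mem_lagrangeSpace hΩ p.2.1).toLp _ = 0 at h
    rw [← MemLp.toLp_zero MemLp.zero', MemLp.toLp_eq_toLp_iff] at h
    exact h
  exact Subtype.ext this

/-- The contribution of the cells to the inverse inequality. -/
theorem sum_setIntegral_component_sq_le (hb : Bornology.IsBounded Ω)
    (ho : IsOpen Ω) {u : Plane → Plane} (hu : u ∈ T.velocity k) (i : Fin 2) :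
    ∑ s ∈ T.level k, ∫ x in convexHull ℝ (s : Set Plane), u x i ^ 2
      ≤ T.triangles.card * ∫ x in Ω, u x i ^ 2 := by
  have hI : Integrable (fun x => u x i ^ 2) (volume.restrict (closure Ω)) :=
    (memLp_closure_of_mem_lagrangeSpace hb (hu.1 i)).integrable_sq
  have hle := (T.sum_restrict_level_le k).trans T.sum_restrict_triangles_le
  have hI' : Integrable (fun x => u x i ^ 2) (T.triangles.card • volume.restrict (closure Ω)) := by
    rw [← Nat.cast_smul_eq_nsmul ENNReal]
    exact hI.smul_measure (by simp)
  have h1 := integral_mono_measure hle (.of_forall fun x => sq_nonneg _) hI'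
  rw [integral_finsetSum_measure fun s hs =>
    integrable_finsetSum_measure.1 (hI'.mono_measure hle) s hs,
    ← Nat.cast_smul_eq_nsmul ENNReal, integral_smul_measure] at h1
  refine h1.trans_eq ?_
  -- The boundary values are zero, so the frontier contributes nothing, whatever its measure.
  have h2 : ∫ x in closure Ω, u x i ^ 2 = ∫ x in Ω, u x i ^ 2 := by
    refine setIntegral_eq_of_subset_of_forall_sdiff_eq_zero isClosed_closure.measurableSet
      subset_closure fun x hx => ?_
    rw [← ho.frontier_eq] at hx
    simp [hu.2 x hx]
  rw [h2]
  simp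

theorem setIntegral_partialDeriv_sq_le_sum {u : Plane → Plane} (hu : u ∈ T.velocity k)
    (i j : Fin 2) : ∫ x in Ω, partialDeriv u i j x ^ 2
      ≤ ∑ s ∈ T.level k, ∫ x in convexHull ℝ (s : Set Plane), partialDeriv u i j x ^ 2 := by
  have hI : ∀ s ∈ T.level k, Integrable (fun x => partialDeriv u i j x ^ 2)
      (volume.restrict (convexHull ℝ (s : Set Plane))) := fun s hs => by
    obtain ⟨c, hc⟩ := T.exists_quad_of_mem_velocity hu hs i
    have h : Integrable (fun x => quad (quadDeriv j c) x ^ 2)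
        (volume.restrict (convexHull ℝ (s : Set Plane))) :=
      ((continuous_quad _).pow 2).continuousOn.integrableOn_compact
        (s.finite_toSet.isCompact_convexHull ℝ)
    refine h.congr ?_
    filter_upwards [ae_mem_interior_convexHull s] with x hx
    rw [T.partialDeriv_eq_quad hu hs hc hx]
  rw [← integral_finsetSum_measure hI]
  refine integral_mono_measure ?_ (.of_forall fun x => sq_nonneg _)
    (integrable_finsetSum_measure.2 hI)
  exact restrict_le_sum_restrict fun x hx => T.exists_mem_level (subset_closure hx) k

/-- The inverse inequality for the velocity spaces, with a constant independent of the level. -/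
theorem exists_inverse_inequality (hb : Bornology.IsBounded Ω) (ho : IsOpen Ω)
    (hne : Ω.Nonempty) : ∃ C : ℝ, 0 < C ∧ ∀ (k : ℕ) (u : T.velocity k) (i j : Fin 2),
      ‖T.partialL2 hb k i j u‖ ^ 2
        ≤ C * (T.gridSize k ^ 2)⁻¹ * ‖T.componentL2 hb k i u‖ ^ 2 := by
  choose c hc0 hc using fun t : Finset Plane =>
    exists_inverse_inequality_quad (t.finite_toSet.isCompact_convexHull ℝ)
      (convex_convexHull ℝ (t : Set Plane))
  set C₀ := ∑ t ∈ T.triangles, c t with hC₀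
  have hC₀0 : 0 ≤ C₀ := Finset.sum_nonneg fun t _ => hc0 t
  refine ⟨C₀ * T.gridSize 0 ^ 2 * T.triangles.card + 1, by positivity, fun k u i j => ?_⟩
  have hk := T.gridSize_pos hne k
  have hcell : ∀ s ∈ T.level k, ∫ x in convexHull ℝ (s : Set Plane), partialDeriv u i j x ^ 2
      ≤ C₀ * T.gridSize 0 ^ 2 * (T.gridSize k ^ 2)⁻¹
        * ∫ x in convexHull ℝ (s : Set Plane), (u : Plane → Plane) x i ^ 2 := fun s hs => by
    obtain ⟨d, hd⟩ := T.exists_quad_of_mem_velocity u.2 hs i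
    obtain ⟨t, ht, a, r, hr, e⟩ := T.exists_affine_of_mem_level hs
    have hr2 : (0 : ℝ) < (1 / 2) ^ k := by positivity
    have hr0 : r ≠ 0 := abs_pos.1 (hr ▸ hr2)
    have h1 : ∫ x in convexHull ℝ (s : Set Plane), partialDeriv u i j x ^ 2
        = ∫ x in convexHull ℝ (s : Set Plane), quad (quadDeriv j d) x ^ 2 := by
      refine integral_congr_ae ?_
      filter_upwards [ae_mem_interior_convexHull s] with x hx
      rw [T.partialDeriv_eq_quad u.2 hs hd hx]
    have h2 : ∫ x in convexHull ℝ (s : Set Plane), (u : Plane → Plane) x i ^ 2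
        = ∫ x in convexHull ℝ (s : Set Plane), quad d x ^ 2 :=
      setIntegral_congr_fun (measurableSet_convexHull s) fun x hx => by simp only [hd x hx]
    have h3 := setIntegral_quadDeriv_image_le (hc t) a hr0 j d
    rw [← convexHull_image_add_smul, ← e] at h3
    rw [h1, h2]
    refine h3.trans (mul_le_mul_of_nonneg_right ?_ (integral_nonneg fun x => sq_nonneg _))
    -- This is h_k ≤ |r| h_0, squared and rearranged.
    have h4 : (r ^ 2)⁻¹ ≤ T.gridSize 0 ^ 2 * (T.gridSize k ^ 2)⁻¹ := by
      have h5 := pow_le_pow_left₀ hk.le (T.gridSize_le k) 2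
      rw [mul_pow, ← hr, sq_abs] at h5
      rw [inv_le_iff_one_le_mul₀' (by positivity), ← mul_assoc, ← div_eq_mul_inv,
        one_le_div (by positivity)]
      exact h5
    rw [mul_assoc]
    exact mul_le_mul (Finset.single_le_sum (fun t _ => hc0 t) ht) h4 (by positivity) hC₀0
  have h1 : ‖T.partialL2 hb k i j u‖ ^ 2 = ∫ x in Ω, partialDeriv u i j x ^ 2 :=
    norm_sq_toLp_two (T.memLp_partialDeriv hb u.2 i j)
  have h2 : ‖T.componentL2 hb k i u‖ ^ 2 = ∫ x in Ω, (u : Plane → Plane) x i ^ 2 :=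
    norm_sq_toLp_two (memLp_of_mem_lagrangeSpace hb (u.2.1 i))
  have h3 : 0 ≤ ∫ x in Ω, (u : Plane → Plane) x i ^ 2 := integral_nonneg fun x => sq_nonneg _
  rw [h1, h2]
  calc _ ≤ _ := T.setIntegral_partialDeriv_sq_le_sum u.2 i j
    _ ≤ _ := Finset.sum_le_sum hcell
    _ = C₀ * T.gridSize 0 ^ 2 * (T.gridSize k ^ 2)⁻¹
        * ∑ s ∈ T.level k, ∫ x in convexHull ℝ (s : Set Plane), (u : Plane → Plane) x i ^ 2 := by
      rw [Finset.mul_sum]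
    _ ≤ C₀ * T.gridSize 0 ^ 2 * (T.gridSize k ^ 2)⁻¹
        * (T.triangles.card * ∫ x in Ω, (u : Plane → Plane) x i ^ 2) :=
      mul_le_mul_of_nonneg_left (T.sum_setIntegral_component_sq_le hb ho u.2 i) (by positivity)
    _ ≤ (C₀ * T.gridSize 0 ^ 2 * T.triangles.card + 1) * (T.gridSize k ^ 2)⁻¹
        * ∫ x in Ω, (u : Plane → Plane) x i ^ 2 := by
      have : 0 ≤ (T.gridSize k ^ 2)⁻¹ * ∫ x in Ω, (u : Plane → Plane) x i ^ 2 := by positivity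
      linarith

end Triangulation

end Stokes

/-! ### Bilinear forms and the matrices that represent them -/

namespace Module.Basis

variable {ι κ V W : Type*} [Fintype ι] [AddCommGroup V] [Module ℝ V] [AddCommGroup W]
  [Module ℝ W] (φ : Module.Basis ι ℝ V)

theorem mulVec_equivFun_of_bilin (F : V →ₗ[ℝ] W →ₗ[ℝ] ℝ) {e : κ → W} {M : Matrix κ ι ℝ}
    (hM : ∀ i j, M i j = F (φ j) (e i)) (u : V) (i : κ) :
    (M *ᵥ φ.equivFun u) i = F u (e i) := by
  conv_rhs => rw [← φ.sum_equivFun u]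
  simp only [Matrix.mulVec, dotProduct, hM, map_sum, map_smul, LinearMap.sum_apply,
    LinearMap.smul_apply, smul_eq_mul, mul_comm]

theorem equivFun_dotProduct_mulVec [Fintype κ] (ψ : Module.Basis κ ℝ W) (F : V →ₗ[ℝ] W →ₗ[ℝ] ℝ)
    {M : Matrix κ ι ℝ} (hM : ∀ i j, M i j = F (φ j) (ψ i)) (u : V) (w : W) :
    ψ.equivFun w ⬝ᵥ (M *ᵥ φ.equivFun u) = F u w := by
  conv_rhs => rw [← ψ.sum_equivFun w]
  rw [map_sum, dotProduct]
  refine Finset.sum_congr rfl fun i _ => ?_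
  rw [φ.mulVec_equivFun_of_bilin F hM, map_smul, smul_eq_mul]

end Module.Basis

namespace Stokes

namespace Triangulation

variable {Ω : Set Plane} (T : Triangulation Ω) (hb : Bornology.IsBounded Ω) (k : ℕ)

/-- The `L²` inner product of velocities as a bilinear form. -/
def velocityMassForm : T.velocity k →ₗ[ℝ] T.velocity k →ₗ[ℝ] ℝ :=
  ∑ i, (innerₗ _).compl₁₂ (T.componentL2 hb k i) (T.componentL2 hb k i)

/-- The form `a` as a bilinear form. -/
def velocityForm (β : ℝ) : T.velocity k →ₗ[ℝ] T.velocity k →ₗ[ℝ] ℝ :=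
  ∑ i, ∑ j, (innerₗ _).compl₁₂ (T.partialL2 hb k i j) (T.partialL2 hb k i j)
    + β • T.velocityMassForm hb k

/-- The `L²` inner product of pressures as a bilinear form. -/
def pressureMassForm : T.pressure k →ₗ[ℝ] T.pressure k →ₗ[ℝ] ℝ :=
  (innerₗ _).compl₁₂ (T.pressureL2 hb k) (T.pressureL2 hb k)

/-- The form `b` as a bilinear form. -/
def divergenceForm : T.velocity k →ₗ[ℝ] T.pressure k →ₗ[ℝ] ℝ :=
  ∑ i, (innerₗ _).compl₁₂ (T.partialL2 hb k i i) (T.pressureL2 hb k)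

variable {k}

theorem velocityMassForm_apply (u w : T.velocity k) :
    T.velocityMassForm hb k u w = vecInner Ω u w := by
  rw [T.vecInner_eq hb]
  simp [velocityMassForm]

theorem velocityForm_apply (β : ℝ) (u w : T.velocity k) :
    T.velocityForm hb k β u w = aForm Ω β u w := by
  rw [aForm, T.gradInner_eq hb, ← T.velocityMassForm_apply hb]
  simp [velocityForm]

theorem pressureMassForm_apply (p q : T.pressure k) :
    T.pressureMassForm hb k p q = scalInner Ω p q := by
  rw [T.scalInner_eq hb]
  simp [pressureMassForm]

theorem divergenceForm_apply (u : T.velocity k) (p : T.pressure k) :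
    T.divergenceForm hb k u p = bForm Ω u p := by
  rw [T.bForm_eq hb]
  simp [divergenceForm]

theorem vecInner_self (u : T.velocity k) :
    vecInner Ω u u = ∑ i, ‖T.componentL2 hb k i u‖ ^ 2 := by
  simp [T.vecInner_eq hb]

theorem gradInner_self (u : T.velocity k) :
    gradInner Ω u u = ∑ i, ∑ j, ‖T.partialL2 hb k i j u‖ ^ 2 := by
  simp [T.gradInner_eq hb]

theorem scalInner_self (p : T.pressure k) :
    scalInner Ω p p = ‖T.pressureL2 hb k p‖ ^ 2 := by
  simp [T.scalInner_eq hb]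

/-- Cauchy–Schwarz; the factor 2 comes from the two terms of the divergence. -/
theorem sq_bForm_le (u : T.velocity k) (p : T.pressure k) :
    bForm Ω u p ^ 2 ≤ 2 * (∑ i, ‖T.partialL2 hb k i i u‖ ^ 2) * scalInner Ω p p := by
  rw [T.bForm_eq hb, T.scalInner_self hb, ← sum_inner, Fin.sum_univ_two, Fin.sum_univ_two]
  set x := T.partialL2 hb k 0 0 u
  set y := T.partialL2 hb k 1 1 u
  have h1 := abs_real_inner_le_norm (x + y) (T.pressureL2 hb k p)
  have h2 := sq_le_sq' (neg_le_of_abs_le h1) (le_of_abs_le h1)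
  refine h2.trans ?_
  rw [mul_pow]
  refine mul_le_mul_of_nonneg_right ?_ (sq_nonneg _)
  have h3 := pow_le_pow_left₀ (norm_nonneg _) (norm_add_le x y) 2
  nlinarith [sq_nonneg (‖x‖ - ‖y‖)]

end Triangulation

/-! ### Definiteness, damping and smoothing for the Taylor–Hood matrices -/

namespace MixedBasis

variable {Ω : Set Plane} {T : Triangulation Ω} {k : ℕ} (D : MixedBasis T k)

theorem dotProduct_A (hb : Bornology.IsBounded Ω) (β : ℝ) (u w : T.velocity k) :
    D.φ.equivFun w ⬝ᵥ (D.A β *ᵥ D.φ.equivFun u) = aForm Ω β u w := by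
  rw [← T.velocityForm_apply hb]
  exact D.φ.equivFun_dotProduct_mulVec D.φ _ (fun i j => (T.velocityForm_apply hb β _ _).symm) u w

theorem dotProduct_B (hb : Bornology.IsBounded Ω) (u : T.velocity k) (p : T.pressure k) :
    D.ψ.equivFun p ⬝ᵥ (D.B *ᵥ D.φ.equivFun u) = bForm Ω u p := by
  rw [← T.divergenceForm_apply hb]
  exact D.φ.equivFun_dotProduct_mulVec D.ψ _ (fun i j => (T.divergenceForm_apply hb _ _).symm) u p

theorem dotProduct_transpose_B (hb : Bornology.IsBounded Ω) (u : T.velocity k)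
    (p : T.pressure k) :
    D.φ.equivFun u ⬝ᵥ ((D.B)ᵀ *ᵥ D.ψ.equivFun p) = bForm Ω u p := by
  rw [← D.dotProduct_B hb, Matrix.mulVec_transpose, dotProduct_comm, ← Matrix.dotProduct_mulVec]

theorem dotProduct_massU (hb : Bornology.IsBounded Ω) (u w : T.velocity k) :
    D.φ.equivFun w ⬝ᵥ (D.massU *ᵥ D.φ.equivFun u) = vecInner Ω u w := by
  rw [← T.velocityMassForm_apply hb]
  exact D.φ.equivFun_dotProduct_mulVec D.φ _
    (fun i j => (T.velocityMassForm_apply hb _ _).symm) u w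

theorem dotProduct_massP (hb : Bornology.IsBounded Ω) (p q : T.pressure k) :
    D.ψ.equivFun q ⬝ᵥ (D.massP *ᵥ D.ψ.equivFun p) = scalInner Ω p q := by
  rw [← T.pressureMassForm_apply hb]
  exact D.ψ.equivFun_dotProduct_mulVec D.ψ _
    (fun i j => (T.pressureMassForm_apply hb _ _).symm) p q

theorem posDef_massU (hb : Bornology.IsBounded Ω) (ho : IsOpen Ω) : D.massU.PosDef := by
  refine .of_dotProduct_mulVec_pos ?_ fun x hx => ?_
  · ext i j
    simp [massU, vecInner, mul_comm]
  · obtain ⟨u, rfl⟩ := D.φ.equivFun.surjective x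
    rw [star_trivial, D.dotProduct_massU hb, T.vecInner_self hb]
    refine (Finset.sum_nonneg fun i _ => sq_nonneg _).lt_of_ne' fun h => hx ?_
    rw [Finset.sum_eq_zero_iff_of_nonneg fun i _ => sq_nonneg _] at h
    have hu : u = 0 := T.eq_zero_of_componentL2 hb ho fun i => by
      simpa using h i (Finset.mem_univ i)
    rw [hu, map_zero]

theorem posDef_massP (hb : Bornology.IsBounded Ω) (ho : IsOpen Ω) : D.massP.PosDef := by
  refine .of_dotProduct_mulVec_pos ?_ fun x hx => ?_
  · ext i j
    simp [massP, scalInner, mul_comm]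
  · obtain ⟨p, rfl⟩ := D.ψ.equivFun.surjective x
    rw [star_trivial, D.dotProduct_massP hb, T.scalInner_self hb]
    refine (sq_nonneg _).lt_of_ne' fun h => hx ?_
    have hp : p = 0 := T.eq_zero_of_pressureL2 hb ho (by simpa using h)
    rw [hp, map_zero]

theorem posDef_Ahat (hb : Bornology.IsBounded Ω) (ho : IsOpen Ω) {β : ℝ} (hβ : 0 < β) :
    (D.Ahat β).PosDef :=
  (D.posDef_massU hb ho).smul (by positivity)

theorem posDef_Shat (hb : Bornology.IsBounded Ω) (ho : IsOpen Ω) (hne : Ω.Nonempty) {β : ℝ}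
    (hβ : 0 < β) : (D.Shat β).PosDef := by
  have := T.gridSize_pos hne k
  exact (D.posDef_massP hb ho).smul (by positivity)

theorem posSemidef_A (hb : Bornology.IsBounded Ω) {β : ℝ} (hβ : 0 < β) :
    (D.A β).PosSemidef := by
  refine .of_dotProduct_mulVec_nonneg ?_ fun x => ?_
  · ext i j
    simp [A, aForm, gradInner, vecInner, mul_comm]
  · obtain ⟨u, rfl⟩ := D.φ.equivFun.surjective x
    rw [star_trivial, D.dotProduct_A hb, aForm, T.gradInner_self hb, T.vecInner_self hb]
    positivity

/-- The damping condition follows from the inverse inequality. -/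
theorem dampingCondition (hb : Bornology.IsBounded Ω) (ho : IsOpen Ω) (hne : Ω.Nonempty) {C : ℝ}
    (hC : 0 < C) (h : ∀ (u : T.velocity k) (i j : Fin 2), ‖T.partialL2 hb k i j u‖ ^ 2
      ≤ C * (T.gridSize k ^ 2)⁻¹ * ‖T.componentL2 hb k i u‖ ^ 2) {β : ℝ} (hβ : 0 < β) :
    D.DampingCondition β (2 * C + 1)⁻¹ (2 * C * (2 * C + 1)⁻¹)⁻¹ := by
  have hk := T.gridSize_pos hne k
  have hη : 0 < (T.gridSize k ^ 2)⁻¹ := by positivity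
  have hAh := D.posDef_Ahat hb ho hβ
  have hSh := D.posDef_Shat hb ho hne hβ
  constructor
  · refine .of_dotProduct_mulVec_nonneg ?_ fun x => ?_
    · exact (hAh.posSemidef.smul (by positivity)).1.sub (D.posSemidef_A hb hβ).1
    · obtain ⟨u, rfl⟩ := D.φ.equivFun.surjective x
      rw [star_trivial, Matrix.sub_mulVec, dotProduct_sub, D.dotProduct_A hb, Ahat,
        Matrix.smul_mulVec, Matrix.smul_mulVec, dotProduct_smul, dotProduct_smul,
        D.dotProduct_massU hb, inv_inv, aForm, T.gradInner_self hb, T.vecInner_self hb]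
      -- Two partial derivatives per component give a(u,u) ≤ (2C h⁻² + β)‖u‖², and 2C + 1 dominates
      -- both 2C and 1.
      have h0 := h u 0 0
      have h1 := h u 0 1
      have h2 := h u 1 0
      have h3 := h u 1 1
      simp only [Fin.sum_univ_two, smul_eq_mul, sub_nonneg]
      set a := ‖T.componentL2 hb k 0 u‖ ^ 2 with ha
      set b := ‖T.componentL2 hb k 1 u‖ ^ 2 with hb'
      have ha0 : 0 ≤ a := by positivity
      have hb0 : 0 ≤ b := by positivity
      have e1 : 0 ≤ (T.gridSize k ^ 2)⁻¹ * (a + b) := by positivity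
      have e2 : 0 ≤ C * β * (a + b) := by positivity
      linarith
  · refine .of_dotProduct_mulVec_nonneg ?_ fun x => ?_
    · have h1 := (hAh.inv.posSemidef.mul_mul_conjTranspose_same D.B)
      rw [Matrix.conjTranspose_eq_transpose_of_trivial] at h1
      exact (hSh.posSemidef.smul (by positivity)).1.sub (h1.smul (by positivity)).1
    · obtain ⟨p, rfl⟩ := D.ψ.equivFun.surjective x
      -- The velocity w with coefficients Â⁻¹Bᵀp turns the Schur complement form into s = b(w, p) =
      -- α‖w‖².
      obtain ⟨w, hw⟩ := D.φ.equivFun.surjective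
        ((D.Ahat β)⁻¹ *ᵥ ((D.B)ᵀ *ᵥ D.ψ.equivFun p))
      set α := (T.gridSize k ^ 2)⁻¹ + β with hα
      have hα0 : 0 < α := by positivity
      have hs1 : D.ψ.equivFun p ⬝ᵥ ((D.B * (D.Ahat β)⁻¹ * (D.B)ᵀ) *ᵥ D.ψ.equivFun p)
          = bForm Ω w p := by
        rw [← D.dotProduct_B hb, hw]
        simp only [Matrix.mulVec_mulVec, Matrix.mul_assoc]
      have hs2 : α * vecInner Ω w w = bForm Ω w p := by
        rw [← D.dotProduct_transpose_B hb, ← D.dotProduct_massU hb]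
        have : D.Ahat β *ᵥ D.φ.equivFun w = (D.B)ᵀ *ᵥ D.ψ.equivFun p := by
          rw [hw, Matrix.mulVec_mulVec,
            Matrix.mul_nonsing_inv _ ((Matrix.isUnit_iff_isUnit_det _).1 hAh.isUnit),
            Matrix.one_mulVec]
        rw [← this, Ahat, Matrix.smul_mulVec, dotProduct_smul, smul_eq_mul]
      have hw0 : 0 ≤ vecInner Ω w w := by
        rw [T.vecInner_self hb]
        positivity
      have hp0 : 0 ≤ scalInner Ω p p := by
        rw [T.scalInner_self hb]
        positivity
      have hle : bForm Ω w p ^ 2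
          ≤ 2 * (C * (T.gridSize k ^ 2)⁻¹ * vecInner Ω w w) * scalInner Ω p p := by
        refine (T.sq_bForm_le hb w p).trans ?_
        refine mul_le_mul_of_nonneg_right (mul_le_mul_of_nonneg_left ?_ zero_le_two) hp0
        rw [T.vecInner_self hb w, Finset.mul_sum]
        exact Finset.sum_le_sum fun i _ => h w i i
      have hkey : bForm Ω w p ≤ 2 * C * ((T.gridSize k ^ 2)⁻¹ * α⁻¹ * scalInner Ω p p) := by
        have e1 : vecInner Ω w w = α⁻¹ * bForm Ω w p := by
          rw [← hs2, inv_mul_cancel_left₀ hα0.ne']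
        -- The bound on s² has a factor ‖w‖² = α⁻¹s on its right-hand side, so one s cancels unless
        -- s = 0.
        rcases (hs2 ▸ mul_nonneg hα0.le hw0 : 0 ≤ bForm Ω w p).eq_or_lt with h0 | h0
        · rw [← h0]
          positivity
        · rw [e1, sq] at hle
          refine le_of_mul_le_mul_right (hle.trans_eq ?_) h0
          ring
      rw [star_trivial, Matrix.sub_mulVec, dotProduct_sub, Matrix.smul_mulVec,
        Matrix.smul_mulVec, dotProduct_smul, dotProduct_smul, hs1, Shat, Matrix.smul_mulVec,
        dotProduct_smul, D.dotProduct_massP hb, inv_inv, sub_nonneg, add_comm β, ← hα]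
      simp only [smul_eq_mul]
      have := mul_le_mul_of_nonneg_left hkey (by positivity : 0 ≤ (2 * C + 1)⁻¹)
      refine this.trans_eq ?_
      ring

/-- The smoothing property follows from the damping condition. -/
theorem smoothingProperty (hb : Bornology.IsBounded Ω) (ho : IsOpen Ω) (hne : Ω.Nonempty)
    {β τ σ : ℝ} (hβ : 0 < β) (hτ : 0 < τ) (hσ : 0 < σ) (h : D.DampingCondition β τ σ) :
    D.SmoothingProperty β τ σ (fun ν => max τ⁻¹ σ⁻¹ * (ν : ℝ) ^ (-(1 / 2) : ℝ)) := by
  constructor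
  · intro F xs x₀ hxs ν hν y _
    -- A bound on the product suffices: the right-hand side is nonnegative and division by zero
    -- yields 0.
    refine div_le_of_le_mul₀ (Real.sqrt_nonneg _)
      (mul_nonneg (by positivity) (Real.sqrt_nonneg _)) ?_
    have hf : D.A β *ᵥ D.φ.equivFun xs.1 + (D.B)ᵀ *ᵥ D.ψ.equivFun xs.2
        = fun i => F (D.φ i, 0) := by
      ext i
      rw [← hxs, Pi.add_apply,
        D.φ.mulVec_equivFun_of_bilin (T.velocityForm hb k β) (e := D.φ) (M := D.A β)
          (fun i j => (T.velocityForm_apply hb β _ _).symm),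
        D.ψ.mulVec_equivFun_of_bilin (T.divergenceForm hb k).flip (e := D.φ) (M := (D.B)ᵀ)
          (fun i j => (T.divergenceForm_apply hb _ _).symm)]
      simp only [Triangulation.mixedForm, ← T.divergenceForm_apply hb, ← T.velocityForm_apply hb,
        map_zero, add_zero, LinearMap.flip_apply]
    have hg : D.B *ᵥ D.φ.equivFun xs.1 = fun j => F (0, D.ψ j) := by
      ext i
      rw [← hxs, D.φ.mulVec_equivFun_of_bilin (T.divergenceForm hb k) (e := D.ψ) (M := D.B)
          (fun i j => (T.divergenceForm_apply hb _ _).symm)]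
      simp only [Triangulation.mixedForm, ← T.divergenceForm_apply hb, ← T.velocityForm_apply hb,
        map_zero, LinearMap.zero_apply, zero_add]
    have key := uzawa_smoothing (D.posDef_Ahat hb ho hβ) (D.posDef_Shat hb ho hne hβ)
      (D.posSemidef_A hb hβ) hτ hσ h.1 h.2 hf hg (D.coords x₀) hν (D.φ.equivFun y.1)
      (D.ψ.equivFun y.2)
    set x := D.smooth β τ σ F ν x₀ with hx
    have hc : (uzawaStep (D.A β) D.B (D.Ahat β) (D.Shat β) τ σ
        (fun i => F (D.φ i, 0)) (fun j => F (0, D.ψ j)))^[ν] (D.coords x₀)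
        = (D.φ.equivFun x.1, D.ψ.equivFun x.2) := (D.coords.apply_symm_apply _).symm
    rw [hc] at key
    simp only [← map_sub, dotProduct_add] at key
    rw [D.dotProduct_A hb, D.dotProduct_transpose_B hb, D.dotProduct_B hb] at key
    have h1 : (D.coords x₀).1 - D.φ.equivFun xs.1 = (D.coords (x₀ - xs)).1 :=
      (map_sub D.φ.equivFun x₀.1 xs.1).symm
    have h2 : (D.coords x₀).2 - D.ψ.equivFun xs.2 = (D.coords (x₀ - xs)).2 :=
      (map_sub D.ψ.equivFun x₀.2 xs.2).symm
    rw [h1, h2] at key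
    exact key
  · have h1 : Filter.Tendsto (fun ν : ℕ => (ν : ℝ) ^ (-(1 / 2) : ℝ)) Filter.atTop (nhds 0) :=
      (tendsto_rpow_neg_atTop (by norm_num)).comp tendsto_natCast_atTop_atTop
    simpa using h1.const_mul (max τ⁻¹ σ⁻¹)

end MixedBasis

end Stokes

end

theorem mainTheorem6 {Ω : Set Stokes.Plane} (hΩ : Stokes.IsPolygonalDomain Ω)
    (T : Stokes.Triangulation Ω) :
    (∃ τ σ : ℝ, 0 < τ ∧ 0 < σ ∧
      ∀ (k : ℕ) (D : Stokes.MixedBasis T k) (β : ℝ), 0 < β → D.DampingCondition β τ σ) ∧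
    (∀ τ σ : ℝ, 0 < τ → 0 < σ →
      (∀ (k : ℕ) (D : Stokes.MixedBasis T k) (β : ℝ), 0 < β → D.DampingCondition β τ σ) →
      ∃ C : ℝ, 0 < C ∧
        ∀ (k : ℕ) (D : Stokes.MixedBasis T k) (β : ℝ), 0 < β →
          D.SmoothingProperty β τ σ (fun ν => C * (ν : ℝ) ^ (-(1 / 2) : ℝ))) := by
  have hb := hΩ.isBounded
  have ho := hΩ.isOpen
  have hne := hΩ.isConnected.nonempty
  refine ⟨?_, fun τ σ hτ hσ h => ⟨max τ⁻¹ σ⁻¹, by positivity, fun k D β hβ =>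
    D.smoothingProperty hb ho hne hβ hτ hσ (h k D β hβ)⟩⟩
  obtain ⟨C, hC, hinv⟩ := T.exists_inverse_inequality hb ho hne
  exact ⟨(2 * C + 1)⁻¹, (2 * C * (2 * C + 1)⁻¹)⁻¹, by positivity, by positivity,
    fun k D β hβ => D.dampingCondition hb ho hne hC (hinv k) hβ⟩
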